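/- Let $d\ge 2$ and $m\ge 2$. Let $v_1,\dots,v_d\in\mathbb{R}^d$ be linearly independent and let $$\Sigma=\{x_1v_1+\cdots+x_dv_d:\ x_1,\dots,x_d\ge 0\}$$ be the simplicial cone they span. We say that $\Sigma$ is strictly invariant for a matrix $A\in GL_d(\mathbb{R})$ if $A(\Sigma\setminus\{0\})\subset\Sigma^\circ$, the interior of $\Sigma$. An $m$-tuple $(A_1,\dots,A_m)$ of real $d\times d$ matrices is called strongly Diophantine if there is a constant $c>0$ such that for every $n\in\mathbb{N}$ and any two distinct words $\mathbf{i}=i_1\ldots i_n$ and $\mathbf{j}=j_1\ldots j_n$ in $\{1,\dots,m\}^n$, $$\|A_{i_1}\cdots A_{i_n}-A_{j_1}\cdots A_{j_n}\|>c^n,$$ where $\|\cdot\|$ is the operator norm with respect to the Euclidean norm on $\mathbb{R}^d$. (i) With respect to Lebesgue measure on $\mathbb{R}^{d^2m}$, almost every $m$-tuple of matrices in $GL_d(\mathbb{R})$ for each of which $\Sigma$ is strictly invariant is strongly Diophantine. In particular, almost every $m$-tuple of matrices in $GL_d(\mathbb{R})$ with all entries positive is strongly Diophantine. (ii) Regard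 $SL_d(\mathbb{R})^m$ as a $(d^2-1)m$-dimensional submanifold of $\mathbb{R}^{d^2m}$, with its natural measure, the $(d^2-1)m$-dimensional Hausdorff measure (a constant multiple of the Riemannian volume induced by the Euclidean metric). With respect to this measure, almost every $m$-tuple of matrices in $SL_d(\mathbb{R})$ for each of which $\Sigma$ is strictly invariant is strongly Diophantine. In particular, almost every $m$-tuple of matrices in $SL_d(\mathbb{R})$ with all entries positive is strongly Diophantine. -/

import Mathlib

open scoped MeasureTheory Matrix

noncomputable section

/-- The product `A_{w_1} ⋯ A_{w_n}` along a word `w` of length `n` over the index set `Λ`. -/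
def wordProd {G Λ : Type*} [Monoid G] (A : Λ → G) {n : ℕ} (w : Fin n → Λ) : G :=
  (List.ofFn fun k => A (w k)).prod

/-- The family `A` is strongly Diophantine for the distance `ρ`: for some `c > 0` and all `n`,
any two distinct words `w ≠ w'` of length `n` satisfy `ρ (A_w, A_w') > c ^ n`. -/
def StronglyDiophantine {G Λ : Type*} [Monoid G] (ρ : G → G → ℝ) (A : Λ → G) : Prop :=
  ∃ c : ℝ, 0 < c ∧ ∀ (n : ℕ) (w w' : Fin n → Λ), w ≠ w' →
    c ^ n < ρ (wordProd A w) (wordProd A w')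

/-- The distance `‖A - B‖`, where `‖·‖` is the operator norm of a matrix acting on Euclidean
space `ℝ^d`. -/
def opDist {d : ℕ} (A B : Matrix (Fin d) (Fin d) ℝ) : ℝ :=
  ‖Matrix.toEuclideanCLM (n := Fin d) (𝕜 := ℝ) (A - B)‖

/-- The cone `{x_1 v_1 + ⋯ + x_d v_d : x_1, …, x_d ≥ 0}`; it is a simplicial cone when the
`v_i` are linearly independent. -/
def coneSpan {d : ℕ} (v : Fin d → Fin d → ℝ) : Set (Fin d → ℝ) :=
  {y | ∃ x : Fin d → ℝ, (∀ i, 0 ≤ x i) ∧ y = ∑ i, x i • v i}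

/-- `S` is strictly invariant for `A`: `A (S \ {0})` is contained in the interior of `S`. -/
def StrictlyInvariant {d : ℕ} (S : Set (Fin d → ℝ)) (A : Matrix (Fin d) (Fin d) ℝ) : Prop :=
  ∀ x ∈ S \ {0}, A *ᵥ x ∈ interior S

/-- All entries of `A` are (strictly) positive. -/
def PositiveEntries {d : ℕ} (A : Matrix (Fin d) (Fin d) ℝ) : Prop :=
  ∀ j k, 0 < A j k

/-- The space `ℝ^(m d^2)` of `m`-tuples of real `d × d` matrices, with its Euclidean metric and
Lebesgue measure. -/
abbrev TupleSpace (d m : ℕ) : Type :=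
  EuclideanSpace ℝ (Fin m × Fin d × Fin d)

/-- The `m`-tuple of matrices with coordinates `a`. -/
def toTuple {d m : ℕ} (a : TupleSpace d m) (i : Fin m) : Matrix (Fin d) (Fin d) ℝ :=
  Matrix.of fun j k => a (i, j, k)

/-- The set of all `m`-tuples of matrices in `GL_d(ℝ)`. -/
def GLTuples (d m : ℕ) : Set (TupleSpace d m) :=
  {a | ∀ i, (toTuple a i).det ≠ 0}

/-- The set of all `m`-tuples of matrices in `SL_d(ℝ)`, a smooth submanifold of `ℝ^(m d^2)` of
dimension `(d^2 - 1) m`. -/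
def SLTuples (d m : ℕ) : Set (TupleSpace d m) :=
  {a | ∀ i, (toTuple a i).det = 1}

/-- The natural measure on the manifold of `m`-tuples in `SL_d(ℝ)`: the Hausdorff measure of
dimension `(d^2 - 1) m` carried by it, which up to a constant factor is the Riemannian volume
induced from the ambient Euclidean space. -/
def slVolume (d m : ℕ) : MeasureTheory.Measure (TupleSpace d m) :=
  (MeasureTheory.Measure.hausdorffMeasure (((d : ℝ) ^ 2 - 1) * m)).restrict (SLTuples d m)

end

/-!
Both parts follow from a projective statement that does not see the scaling of the matrices. In the
basis `v`, a matrix leaving the cone strictly invariant has positive entries, and conjugation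
distorts the operator norm only by a constant; so let the matrices `A_i` have positive entries.
Write `topShare j₀ A` for the share of the coordinate `j₀` in the image under `A` of the all-ones
vector. It suffices that `topShare` separates words with distinct first letters by `c ^ n`
(`ProjectivelyDiophantine`): products of positive matrices are at least exponentially large, and
a common prefix of two words can be cancelled by invertibility.

To show that almost every positive tuple has this property, fix a tuple `E` of positive rank-one
matrices with projectively distinct images. By Fubini, it is enough to consider each real line
`A + s E` separately (`ae_projectivelyDiophantine_line`). Far out on the line, `A_i + s E_i` maps
the positive cone close to the ray through the image of `E_i`, so that words with distinct first
letters are uniformly separated there (`eventually_separated`). Near each real `s` for which the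
tuple is positive, the shares extend to holomorphic functions of `s` bounded by one, on a disc
independent of the word, because complex matrices close to positive ones preserve the cone
`InSector` (`NearlyPositive.inSector_mulVec`). For such a family of functions, Newton interpolation
at a fixed number `k` of points propagates the lower bound along the line and shows that each
function is at most `c ^ n` only on a set of measure `O(θ ^ n)`, where `c` is of the order of
`θ ^ k`. For small `θ` this beats the exponential number of pairs of words, and `θ → 0` gives the
claim (`ae_exists_pow_lt_norm`).

For determinant one, Fubini yields a null slice of the exceptional set, with one diagonal entry of
each matrix prescribed. As the exceptional set is invariant under scaling each matrix, its
part in `SL_d ^ m` is the image of this slice under the locally Lipschitz map that normalizes the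
determinants, hence null for the Hausdorff measure of dimension `(d ^ 2 - 1) * m`.
-/

open Metric Filter Topology MeasureTheory

/-! ### Smallness of holomorphic functions on separated points -/

/-- Divided differences do not grow: the first divided difference of a function bounded by `M` on
`ball c (9 * r)`, based at a point of `ball c r`, is bounded by `M / (4 * r)`. -/
theorem norm_dslope_le_of_mem_ball {c t : ℂ} {r M : ℝ} (hr : 0 < r) {f : ℂ → ℂ}
    (hf : DifferentiableOn ℂ f (ball c (9 * r))) (hM : ∀ z ∈ ball c (9 * r), ‖f z‖ ≤ M)
    (ht : t ∈ ball c r) {z : ℂ} (hz : z ∈ ball c (9 * r)) :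
    ‖dslope f t z‖ ≤ M / (4 * r) := by
  have htc : dist t c < r := ht
  have hsub : ball t (8 * r) ⊆ ball c (9 * r) := ball_subset_ball' (by linarith)
  have htb : t ∈ ball c (9 * r) := by rw [mem_ball]; linarith
  have h2 : 2 * M / (8 * r) = M / (4 * r) := by field_simp; ring
  have hdiff : ∀ w ∈ ball c (9 * r), ‖f w - f t‖ ≤ 2 * M := fun w hw =>
    (norm_sub_le _ _).trans (by linarith [hM w hw, hM t htb])
  rw [← h2]
  by_cases hzt : z ∈ ball t (8 * r)
  · refine Complex.norm_dslope_le_div_of_mapsTo_ball (hf.mono hsub) (fun w hw => ?_) hzt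
    rw [mem_closedBall, dist_eq_norm]
    exact hdiff w (hsub hw)
  · have hd : 8 * r ≤ ‖z - t‖ := by
      rw [mem_ball, not_lt, dist_eq_norm] at hzt; exact hzt
    have hne : z ≠ t := by
      rintro rfl; simp at hd; linarith
    rw [dslope_of_ne _ hne, slope_def_field, norm_div]
    have hM0 : 0 ≤ M := (norm_nonneg _).trans (hM t htb)
    exact div_le_div₀ (by linarith) (hdiff z hz) (by linarith) hd

/-- Quantitative interpolation. A bounded holomorphic function that is at most `ε` at `k` points
with mutual distances at least `γ` is at most `O(ε) + M / 2 ^ k` on a smaller disc. The proof is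
Newton interpolation, carried out by taking one divided difference at a time. -/
theorem norm_le_of_norm_le_on_separated {c : ℂ} {r γ : ℝ} (hr : 0 < r) (hγ : 0 < γ)
    (T : Finset ℂ) (hT : ∀ t ∈ T, t ∈ ball c r)
    (hsep : ∀ t ∈ T, ∀ t' ∈ T, t ≠ t' → γ ≤ ‖t - t'‖) :
    ∀ (f : ℂ → ℂ) (M ε : ℝ), DifferentiableOn ℂ f (ball c (9 * r)) →
      (∀ z ∈ ball c (9 * r), ‖f z‖ ≤ M) → (∀ t ∈ T, ‖f t‖ ≤ ε) → ∀ s ∈ ball c r,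
      ‖f s‖ ≤ ε * (∑ i ∈ Finset.range T.card, (4 * r / γ) ^ i) + M * (1 / 2) ^ T.card := by
  classical
  induction T using Finset.induction_on with
  | empty =>
    intro f M ε _ hM _ s hs
    have hs' : s ∈ ball c (9 * r) := ball_subset_ball (by linarith) hs
    simpa using hM s hs'
  | insert t T htT ih =>
    intro f M ε hf hM hε s hs
    have ht : t ∈ ball c r := hT t (Finset.mem_insert_self _ _)
    have htb : t ∈ ball c (9 * r) := ball_subset_ball (by linarith) ht
    have hεt : ‖f t‖ ≤ ε := hε t (Finset.mem_insert_self _ _)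
    have hg := ih (fun u hu => hT u (Finset.mem_insert_of_mem hu))
      (fun u hu u' hu' => hsep u (Finset.mem_insert_of_mem hu) u' (Finset.mem_insert_of_mem hu'))
      (dslope f t) (M / (4 * r)) (2 * ε / γ)
      ((Complex.differentiableOn_dslope (isOpen_ball.mem_nhds htb)).2 hf)
      (fun z hz => norm_dslope_le_of_mem_ball hr hf hM ht hz)
      (fun u hu => by
        have hne : u ≠ t := fun h => htT (h ▸ hu)
        have h1 : γ ≤ ‖u - t‖ := hsep u (Finset.mem_insert_of_mem hu) t
          (Finset.mem_insert_self _ _) hne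
        rw [dslope_of_ne _ hne, slope_def_field, norm_div]
        refine div_le_div₀ (by linarith [norm_nonneg (f t)]) ?_ hγ h1
        exact (norm_sub_le _ _).trans (by linarith [hε u (Finset.mem_insert_of_mem hu)]))
      s hs
    have hst : ‖s - t‖ ≤ 2 * r := by
      have h1 : dist s c < r := hs
      have h2 : dist t c < r := ht
      rw [← dist_eq_norm]
      linarith [dist_triangle_right s t c]
    have hfs : f s = f t + (s - t) * dslope f t s := by
      have := sub_smul_dslope f t s
      rw [smul_eq_mul] at this
      rw [this]; ring
    have hprod : ‖(s - t) * dslope f t s‖ ≤ 2 * r * (2 * ε / γ *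
        (∑ i ∈ Finset.range T.card, (4 * r / γ) ^ i) + M / (4 * r) * (1 / 2) ^ T.card) := by
      rw [norm_mul]
      exact mul_le_mul hst hg (norm_nonneg _) (by linarith)
    rw [Finset.card_insert_of_notMem htT, Finset.sum_range_succ']
    simp only [pow_succ, pow_zero]
    rw [← Finset.sum_mul, hfs]
    refine (norm_add_le _ _).trans ?_
    have : 2 * r * (2 * ε / γ *
        (∑ i ∈ Finset.range T.card, (4 * r / γ) ^ i) + M / (4 * r) * (1 / 2) ^ T.card) =
        ε * ((∑ i ∈ Finset.range T.card, (4 * r / γ) ^ i) * (4 * r / γ)) +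
          M * ((1 / 2) ^ T.card * (1 / 2)) := by
      field_simp; ring
    linarith

/-- A set of reals of measure more than `2 * k * γ` contains `k` points with mutual distances at
least `γ`. -/
theorem exists_separated_finset {E : Set ℝ} {γ : ℝ} (hγ : 0 < γ) (k : ℕ)
    (hE : ENNReal.ofReal (2 * k * γ) < volume E) :
    ∃ T : Finset ℝ, ↑T ⊆ E ∧ T.card = k ∧ ∀ t ∈ T, ∀ t' ∈ T, t ≠ t' → γ ≤ |t - t'| := by
  induction k with
  | zero => exact ⟨∅, by simp, rfl, by simp⟩
  | succ k ih =>
    have hk : ENNReal.ofReal (2 * k * γ) ≤ ENNReal.ofReal (2 * (k + 1 : ℕ) * γ) := by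
      apply ENNReal.ofReal_le_ofReal; push_cast; nlinarith
    obtain ⟨T, hTE, hcard, hsep⟩ := ih (hk.trans_lt hE)
    have hcov : volume (⋃ t ∈ T, ball t γ) ≤ ENNReal.ofReal (2 * k * γ) := by
      refine (measure_biUnion_finset_le _ _).trans ?_
      simp only [Real.volume_ball, Finset.sum_const, hcard, nsmul_eq_mul]
      rw [← ENNReal.ofReal_natCast, ← ENNReal.ofReal_mul (by positivity)]
      apply ENNReal.ofReal_le_ofReal; linarith
    obtain ⟨x, hxE, hx⟩ : ∃ x ∈ E, x ∉ ⋃ t ∈ T, ball t γ := by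
      by_contra! h
      exact absurd ((measure_mono h).trans (hcov.trans hk)) (not_le.2 hE)
    have hx' : ∀ t ∈ T, γ ≤ |x - t| := by
      intro t ht
      simp only [Set.mem_iUnion, not_exists, mem_ball, not_lt, Real.dist_eq] at hx
      exact hx t ht
    have hxT : x ∉ T := fun h => by have := hx' x h; simp at this; linarith
    refine ⟨insert x T, ?_, by rw [Finset.card_insert_of_notMem hxT, hcard], ?_⟩
    · rw [Finset.coe_insert]; exact Set.insert_subset hxE hTE
    · intro t ht t' ht' hne
      rcases Finset.mem_insert.1 ht with h1 | h1 <;> rcases Finset.mem_insert.1 ht' with h2 | h2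
      · exact absurd (h1.trans h2.symm) hne
      · rw [h1]; exact hx' _ h2
      · rw [h2, abs_sub_comm]; exact hx' _ h1
      · exact hsep _ h1 _ h2 hne

/-- The interpolation estimate for small values on a real set `E` of measure more than
`2 * k * γ`. -/
theorem norm_le_of_norm_le_on_large_set {c r γ : ℝ} (hr : 0 < r) (hγ : 0 < γ) (k : ℕ)
    {E : Set ℝ} (hEc : E ⊆ ball c r) (hE : ENNReal.ofReal (2 * k * γ) < volume E)
    {f : ℂ → ℂ} {M ε : ℝ} (hf : DifferentiableOn ℂ f (ball (c : ℂ) (9 * r)))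
    (hM : ∀ z ∈ ball (c : ℂ) (9 * r), ‖f z‖ ≤ M) (hε : ∀ t ∈ E, ‖f (t : ℂ)‖ ≤ ε)
    {s : ℝ} (hs : s ∈ ball c r) :
    ‖f (s : ℂ)‖ ≤ ε * (∑ i ∈ Finset.range k, (4 * r / γ) ^ i) + M * (1 / 2) ^ k := by
  classical
  obtain ⟨T, hTE, hcard, hsep⟩ := exists_separated_finset hγ k hE
  have hball : ∀ x ∈ ball c r, (x : ℂ) ∈ ball (c : ℂ) r := by
    intro x hx
    rw [mem_ball, Complex.dist_eq, ← Complex.ofReal_sub, Complex.norm_real]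
    simpa [Real.dist_eq] using hx
  have key := norm_le_of_norm_le_on_separated (c := (c : ℂ)) hr hγ
    (T.map ⟨((↑) : ℝ → ℂ), Complex.ofReal_injective⟩)
    (by
      intro t ht
      obtain ⟨x, hx, rfl⟩ := Finset.mem_map.1 ht
      exact hball x (hEc (hTE hx)))
    (by
      intro t ht t' ht' hne
      obtain ⟨x, hx, rfl⟩ := Finset.mem_map.1 ht
      obtain ⟨y, hy, rfl⟩ := Finset.mem_map.1 ht'
      have := hsep x hx y hy (fun h => hne (by rw [h]))
      simp only [Function.Embedding.coeFn_mk]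
      rwa [← Complex.ofReal_sub, Complex.norm_real, Real.norm_eq_abs])
    f M ε hf hM
    (by
      intro t ht
      obtain ⟨x, hx, rfl⟩ := Finset.mem_map.1 ht
      exact hε x (hTE hx))
    s (hball s hs)
  simpa [hcard] using key

theorem exists_mul_half_pow_le (M : ℝ) {δ : ℝ} (hδ : 0 < δ) : ∃ k : ℕ, M * (1 / 2) ^ k ≤ δ / 2 := by
  have h : Tendsto (fun k : ℕ => M * (1 / 2 : ℝ) ^ k) atTop (𝓝 (M * 0)) :=
    (tendsto_pow_atTop_nhds_zero_of_lt_one (by norm_num) (by norm_num)).const_mul M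
  rw [mul_zero] at h
  exact ((h.eventually (Iic_mem_nhds (half_pos hδ))).exists)

theorem exists_pos_ofReal_mul_lt (k : ℕ) {v : ENNReal} (hv : 0 < v) (hfin : v ≠ ⊤) :
    ∃ γ : ℝ, 0 < γ ∧ ENNReal.ofReal (2 * k * γ) < v := by
  have hv' : 0 < v.toReal := ENNReal.toReal_pos hv.ne' hfin
  refine ⟨v.toReal / (2 * (k + 1)), by positivity, ?_⟩
  rw [ENNReal.ofReal_lt_iff_lt_toReal (by positivity) hfin, ← mul_div_assoc,
    div_lt_iff₀ (by positivity)]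
  nlinarith

theorem div_mul_le_div_four {δ C : ℝ} (hδ : 0 ≤ δ) (hC : 0 ≤ C) :
    δ / (4 * (C + 1)) * C ≤ δ / 4 := by
  rw [div_mul_eq_mul_div, div_le_div_iff₀ (by positivity) (by norm_num)]
  nlinarith

/-! ### Families of holomorphic functions along a real interval -/

/-- Propagation of lower bounds. If a family of functions is locally uniformly bounded and
holomorphic near a connected open set `I` of reals, and is uniformly bounded below at one point of
`I`, then near every point of `I` each member of the family is large somewhere, uniformly: the set
of such points is open in `I` by interpolation, and it is plainly closed. -/
theorem exists_forall_exists_le_norm {ι : Type*} (f : ι → ℂ → ℂ) {I : Set ℝ} (hI : IsOpen I)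
    (hIc : IsPreconnected I) (M : ℝ)
    (hf : ∀ s ∈ I, ∃ R > 0, ∀ i, DifferentiableOn ℂ (f i) (ball (s : ℂ) R) ∧
      ∀ z ∈ ball (s : ℂ) R, ‖f i z‖ ≤ M)
    {s₀ δ : ℝ} (hs₀ : s₀ ∈ I) (hδ : 0 < δ) (h₀ : ∀ i, δ ≤ ‖f i s₀‖) :
    ∀ s ∈ I, ∀ r > 0, ∃ δ' > 0, ∀ i, ∃ s' ∈ ball s r, δ' ≤ ‖f i (s' : ℝ)‖ := by
  set G : Set ℝ := {s | ∀ r > 0, ∃ δ' > 0, ∀ i, ∃ s' ∈ ball s r, δ' ≤ ‖f i (s' : ℝ)‖} with hG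
  have hs₀G : s₀ ∈ G := fun r hr => ⟨δ, hδ, fun i => ⟨s₀, mem_ball_self hr, h₀ i⟩⟩
  have hclosed : closure G ⊆ G := by
    intro s hs r hr
    obtain ⟨s', hs'G, hs'⟩ := Metric.mem_closure_iff.1 hs (r / 2) (half_pos hr)
    obtain ⟨δ', hδ', h⟩ := hs'G (r / 2) (half_pos hr)
    refine ⟨δ', hδ', fun i => ?_⟩
    obtain ⟨u, hu, hfu⟩ := h i
    exact ⟨u, ball_subset_ball' (by rw [dist_comm]; linarith) hu, hfu⟩
  have hopen : ∀ s ∈ I, s ∈ G → ∃ r > 0, ball s r ⊆ G := by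
    intro s hsI hsG
    obtain ⟨R, hR, hfR⟩ := hf s hsI
    obtain ⟨r, hr, rfl⟩ : ∃ r > 0, R = 9 * r := ⟨R / 9, by positivity, by ring⟩
    refine ⟨r, hr, fun s₁ hs₁ ρ hρ => ?_⟩
    obtain ⟨δ', hδ', hsG'⟩ := hsG r hr
    obtain ⟨k, hk⟩ := exists_mul_half_pow_le M hδ'
    have hvol : volume (ball s r ∩ ball s₁ ρ) ≠ 0 :=
      (isOpen_ball.inter isOpen_ball).measure_ne_zero _ ⟨s₁, hs₁, mem_ball_self hρ⟩
    have hfin : volume (ball s r ∩ ball s₁ ρ) ≠ ⊤ :=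
      measure_ne_top_of_subset Set.inter_subset_left measure_ball_lt_top.ne
    obtain ⟨γ, hγ, hE⟩ := exists_pos_ofReal_mul_lt k (pos_iff_ne_zero.2 hvol) hfin
    set C : ℝ := ∑ i ∈ Finset.range k, (4 * r / γ) ^ i
    have hC0 : 0 ≤ C := Finset.sum_nonneg fun i _ => by positivity
    refine ⟨δ' / (4 * (C + 1)), by positivity, fun i => ?_⟩
    by_contra! hcon
    obtain ⟨s', hs', hfs'⟩ := hsG' i
    have := norm_le_of_norm_le_on_large_set hr hγ k Set.inter_subset_left hE (hfR i).1 (hfR i).2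
      (fun t ht => (hcon t ht.2).le) hs'
    have h4 : δ' / (4 * (C + 1)) * C ≤ δ' / 4 := div_mul_le_div_four hδ'.le hC0
    linarith
  have hsub : I ⊆ interior G ∩ I := by
    have := hIc.subset_of_closure_inter_subset (u := interior G ∩ I)
      (isOpen_interior.inter hI)
      ⟨s₀, hs₀, by
        obtain ⟨r, hr, h⟩ := hopen s₀ hs₀ hs₀G
        exact mem_interior.2 ⟨_, h, isOpen_ball, mem_ball_self hr⟩, hs₀⟩
      (by
        rintro s ⟨hs, hsI⟩
        have hsG : s ∈ G :=
          hclosed (closure_mono (Set.inter_subset_left.trans interior_subset) hs)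
        obtain ⟨r, hr, h⟩ := hopen s hsI hsG
        exact ⟨mem_interior.2 ⟨_, h, isOpen_ball, mem_ball_self hr⟩, hsI⟩)
    exact this
  exact fun s hs => interior_subset (hsub hs).1

/-- The local measure estimate: if every member of the family is at least `δ` somewhere on the
real ball, then off a set of measure `O(θ)`, all functions indexed by `W n` exceed a
fixed exponential `c ^ n`. -/
theorem exists_measure_le_pow_le {W : ℕ → Type*} [∀ n, Fintype (W n)] {N : ℕ}
    (hW : ∀ n, Fintype.card (W n) ≤ N ^ n) (f : ∀ n, W n → ℂ → ℂ) {s r M δ : ℝ} (hr : 0 < r)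
    (hf : ∀ n w, DifferentiableOn ℂ (f n w) (ball (s : ℂ) (9 * r)) ∧
      ∀ z ∈ ball (s : ℂ) (9 * r), ‖f n w z‖ ≤ M)
    (hδ : 0 < δ) (hlow : ∀ n w, ∃ s' ∈ ball s r, δ ≤ ‖f n w (s' : ℝ)‖) :
    ∃ C : ℝ, 0 ≤ C ∧ ∀ θ : ℝ, 0 < θ → θ ≤ 1 → N * θ ≤ 1 / 2 → ∃ c > 0,
      volume {x ∈ ball s r | ∃ n, 1 ≤ n ∧ ∃ w, ‖f n w (x : ℝ)‖ ≤ c ^ n} ≤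
        ENNReal.ofReal (C * θ) := by
  obtain ⟨k, hk⟩ := exists_mul_half_pow_le M hδ
  refine ⟨2 * (2 * k * (4 * r)) * N, by positivity, fun θ hθ hθ1 hNθ => ?_⟩
  set κ : ℝ := min 1 (δ / (4 * (k + 1))) with hκ
  have hκ0 : 0 < κ := lt_min one_pos (by positivity)
  have hκ1 : κ ≤ 1 := min_le_left _ _
  have hκδ : κ * k ≤ δ / 4 := by
    have h1 : κ ≤ δ / (4 * (k + 1)) := min_le_right _ _
    rw [le_div_iff₀ (by positivity)] at h1
    nlinarith
  -- Scales: points are separated by `4 r θ ^ n`, values are at most `(κ θ ^ k) ^ n`; the powers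
  -- of `θ` cancel in the interpolation estimate.
  refine ⟨κ * θ ^ k, by positivity, ?_⟩
  have hone : ∀ n, 1 ≤ n → ∀ w, volume {x ∈ ball s r | ‖f n w (x : ℝ)‖ ≤ (κ * θ ^ k) ^ n} ≤
      ENNReal.ofReal (2 * k * (4 * r * θ ^ n)) := by
    intro n hn w
    by_contra! hcon
    obtain ⟨s', hs', hfs'⟩ := hlow n w
    have := norm_le_of_norm_le_on_large_set hr (by positivity : 0 < 4 * r * θ ^ n) k
      (fun x hx => hx.1) hcon (hf n w).1 (hf n w).2 (fun t ht => ht.2) hs'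
    have hdiv : 4 * r / (4 * r * θ ^ n) = (θ ^ n)⁻¹ := by field_simp
    rw [hdiv] at this
    have hsum : (κ * θ ^ k) ^ n * ∑ i ∈ Finset.range k, ((θ ^ n)⁻¹) ^ i ≤ κ * k := by
      rw [Finset.mul_sum]
      calc _ ≤ ∑ i ∈ Finset.range k, κ := by
            refine Finset.sum_le_sum fun i hi => ?_
            have hik : i ≤ k := (Finset.mem_range.1 hi).le
            have hθn0 : 0 < θ ^ n := by positivity
            have hθn1 : θ ^ n ≤ 1 := pow_le_one₀ hθ.le hθ1
            have e1 : (κ * θ ^ k) ^ n * ((θ ^ n)⁻¹) ^ i = κ ^ n * ((θ ^ n) ^ k * ((θ ^ n)⁻¹) ^ i) := by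
              rw [mul_pow, ← pow_mul, ← pow_mul, mul_comm k n]; ring
            have e2 : (θ ^ n) ^ k * ((θ ^ n)⁻¹) ^ i ≤ 1 := by
              rw [inv_pow, ← div_eq_mul_inv, div_le_one (by positivity)]
              exact pow_le_pow_of_le_one hθn0.le hθn1 hik
            rw [e1]
            have e3 : κ ^ n ≤ κ := by
              simpa using pow_le_pow_of_le_one hκ0.le hκ1 hn
            calc κ ^ n * ((θ ^ n) ^ k * ((θ ^ n)⁻¹) ^ i) ≤ κ ^ n * 1 := by gcongr
              _ ≤ κ := by linarith
        _ = κ * k := by simp [mul_comm]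
    linarith
  have hgeo : ∑' n : ℕ, ENNReal.ofReal ((N * θ) ^ n) ≤ ENNReal.ofReal 2 := by
    have h0 : 0 ≤ (N : ℝ) * θ := by positivity
    have hlt : (N : ℝ) * θ < 1 := by linarith
    rw [← ENNReal.ofReal_tsum_of_nonneg (fun n => by positivity)
      (summable_geometric_of_lt_one h0 hlt), tsum_geometric_of_lt_one h0 hlt]
    apply ENNReal.ofReal_le_ofReal
    rw [inv_le_comm₀ (by linarith) (by norm_num)]
    linarith
  have hsubset : {x ∈ ball s r | ∃ n, 1 ≤ n ∧ ∃ w, ‖f n w (x : ℝ)‖ ≤ (κ * θ ^ k) ^ n} ⊆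
      ⋃ n : ℕ, ⋃ w : W (n + 1), {x ∈ ball s r | ‖f (n + 1) w (x : ℝ)‖ ≤ (κ * θ ^ k) ^ (n + 1)} := by
    rintro x ⟨hx, n, hn, w, hw⟩
    obtain ⟨n, rfl⟩ : ∃ l, n = l + 1 := ⟨n - 1, by omega⟩
    exact Set.mem_iUnion.2 ⟨n, Set.mem_iUnion.2 ⟨w, hx, hw⟩⟩
  calc _ ≤ ∑' n : ℕ, volume (⋃ w : W (n + 1),
          {x ∈ ball s r | ‖f (n + 1) w (x : ℝ)‖ ≤ (κ * θ ^ k) ^ (n + 1)}) :=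
        (measure_mono hsubset).trans (measure_iUnion_le _)
    _ ≤ ∑' n : ℕ, ENNReal.ofReal (2 * k * (4 * r) * N * θ) * ENNReal.ofReal ((N * θ) ^ n) := by
        refine ENNReal.tsum_le_tsum fun n => ?_
        refine (measure_iUnion_fintype_le _ _).trans ?_
        refine (Finset.sum_le_sum fun w _ => hone (n + 1) (by omega) w).trans ?_
        rw [Finset.sum_const, nsmul_eq_mul, ← ENNReal.ofReal_mul (by positivity),
          ← ENNReal.ofReal_natCast, ← ENNReal.ofReal_mul (by positivity)]
        apply ENNReal.ofReal_le_ofReal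
        have hcard : ((Finset.univ : Finset (W (n + 1))).card : ℝ) ≤ (N : ℝ) ^ (n + 1) := by
          rw [Finset.card_univ]; exact_mod_cast hW (n + 1)
        calc _ ≤ (N : ℝ) ^ (n + 1) * (2 * k * (4 * r * θ ^ (n + 1))) := by gcongr
          _ = _ := by rw [mul_pow]; ring
    _ = ENNReal.ofReal (2 * k * (4 * r) * N * θ) * ∑' n : ℕ, ENNReal.ofReal ((N * θ) ^ n) :=
        ENNReal.tsum_mul_left
    _ ≤ ENNReal.ofReal (2 * k * (4 * r) * N * θ) * ENNReal.ofReal 2 := by gcongr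
    _ = _ := by
        rw [← ENNReal.ofReal_mul (by positivity)]; congr 1; ring

/-- Let `f n w`, for `w` in a set `W n` of at most exponential size, be functions that are
locally uniformly bounded and holomorphic near an open connected set `I` of reals and uniformly
bounded below at one point of `I`. Then for almost every `x ∈ I` the values at `x` decay at most
exponentially fast. -/
theorem ae_exists_pow_lt_norm {W : ℕ → Type*} [∀ n, Fintype (W n)] {N : ℕ}
    (hW : ∀ n, Fintype.card (W n) ≤ N ^ n) (f : ∀ n, W n → ℂ → ℂ) {I : Set ℝ} (hI : IsOpen I)
    (hIc : IsPreconnected I) (M : ℝ)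
    (hf : ∀ s ∈ I, ∃ R > 0, ∀ n w, DifferentiableOn ℂ (f n w) (ball (s : ℂ) R) ∧
      ∀ z ∈ ball (s : ℂ) R, ‖f n w z‖ ≤ M)
    {s₀ δ : ℝ} (hs₀ : s₀ ∈ I) (hδ : 0 < δ) (h₀ : ∀ n w, δ ≤ ‖f n w s₀‖) :
    ∀ᵐ x : ℝ, x ∈ I → ∃ c > 0, ∀ n, 1 ≤ n → ∀ w, c ^ n < ‖f n w x‖ := by
  have hlow := exists_forall_exists_le_norm (fun p : Σ n, W n => f p.1 p.2) hI hIc M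
    (fun s hs => by
      obtain ⟨R, hR, h⟩ := hf s hs
      exact ⟨R, hR, fun p => h p.1 p.2⟩)
    hs₀ hδ (fun p => h₀ p.1 p.2)
  rw [ae_iff]
  refine measure_null_of_locally_null _ fun s hs => ?_
  have hsI : s ∈ I := by
    by_contra h; exact hs fun h' => absurd h' h
  obtain ⟨R, hR, hfR⟩ := hf s hsI
  obtain ⟨r, hr, rfl⟩ : ∃ r > 0, R = 9 * r := ⟨R / 9, by positivity, by ring⟩
  obtain ⟨δ', hδ', hl⟩ := hlow s hsI r hr
  obtain ⟨C, hC, hmeas⟩ := exists_measure_le_pow_le hW f hr hfR hδ' (fun n w => hl ⟨n, w⟩)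
  refine ⟨_, inter_mem_nhdsWithin _ (ball_mem_nhds s hr), ?_⟩
  set B := {a : ℝ | ¬(a ∈ I → ∃ c > 0, ∀ n, 1 ≤ n → ∀ w, c ^ n < ‖f n w a‖)} ∩ ball s r
  have hB : ∀ θ : ℝ, 0 < θ → θ ≤ 1 → N * θ ≤ 1 / 2 → volume B ≤ ENNReal.ofReal (C * θ) := by
    intro θ h1 h2 h3
    obtain ⟨c, hc, hv⟩ := hmeas θ h1 h2 h3
    refine (measure_mono ?_).trans hv
    rintro x ⟨hx, hxb⟩
    refine ⟨hxb, ?_⟩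
    by_contra! hcon
    exact hx fun _ => ⟨c, hc, hcon⟩
  have hlim : Tendsto (fun θ : ℝ => ENNReal.ofReal (C * θ)) (𝓝[>] 0) (𝓝 0) := by
    have h : Tendsto (fun θ : ℝ => ENNReal.ofReal (C * θ)) (𝓝 0) (𝓝 (ENNReal.ofReal (C * 0))) :=
      (ENNReal.continuous_ofReal.comp (continuous_const.mul continuous_id)).tendsto 0
    simp only [mul_zero, ENNReal.ofReal_zero] at h
    exact h.mono_left nhdsWithin_le_nhds
  refine le_antisymm (ge_of_tendsto hlim ?_) (zero_le)
  have e1 : ∀ᶠ θ : ℝ in 𝓝[>] 0, θ ≤ 1 :=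
    nhdsWithin_le_nhds (Iic_mem_nhds one_pos)
  have e2 : ∀ᶠ θ : ℝ in 𝓝[>] 0, (N : ℝ) * θ ≤ 1 / 2 := by
    have h : Tendsto (fun θ : ℝ => (N : ℝ) * θ) (𝓝 0) (𝓝 ((N : ℝ) * 0)) :=
      (continuous_const.mul continuous_id).tendsto 0
    rw [mul_zero] at h
    exact nhdsWithin_le_nhds (h.eventually (Iic_mem_nhds (by norm_num)))
  filter_upwards [self_mem_nhdsWithin, e1, e2] with θ h1 h2 h3
  exact hB θ h1 h2 h3

/-! ### Products along words -/

theorem wordProd_succ {G Λ : Type*} [Monoid G] (A : Λ → G) {n : ℕ} (w : Fin (n + 1) → Λ) :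
    wordProd A w = A (w 0) * wordProd A (Fin.tail w) := by
  simp [wordProd, List.ofFn_succ, Fin.tail]

theorem wordProd_zero {G Λ : Type*} [Monoid G] (A : Λ → G) (w : Fin 0 → Λ) :
    wordProd A w = 1 := by
  simp [wordProd]

theorem map_wordProd {G H Λ : Type*} [Monoid G] [Monoid H] (φ : G →* H) (A : Λ → G) {n : ℕ}
    (w : Fin n → Λ) : φ (wordProd A w) = wordProd (fun i => φ (A i)) w := by
  simp only [wordProd, map_list_prod, List.map_ofFn, Function.comp_def]

/-- The share of the coordinate `j₀` in the image under `A` of the all-ones vector. It depends on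
`A` only up to scaling. -/
noncomputable def topShare {F n : Type*} [Field F] [Fintype n] (j₀ : n) (A : Matrix n n F) : F :=
  (A *ᵥ 1) j₀ / ∑ j, (A *ᵥ 1) j

/-- A projective form of the strong Diophantine property, for words with distinct first letters:
the images of the all-ones vector are separated projectively, as seen by the coordinate `j₀`. -/
def ProjectivelyDiophantine {n Λ : Type*} [Fintype n] [DecidableEq n] (j₀ : n)
    (A : Λ → Matrix n n ℝ) : Prop :=
  ∃ c : ℝ, 0 < c ∧ ∀ (l : ℕ) (w w' : Fin (l + 1) → Λ), w 0 ≠ w' 0 →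
    c ^ (l + 1) < |topShare j₀ (wordProd A w) - topShare j₀ (wordProd A w')|

theorem topShare_map_ofReal {n : Type*} [Fintype n] (j₀ : n) (A : Matrix n n ℝ) :
    topShare j₀ (A.map Complex.ofReal) = ((topShare j₀ A : ℝ) : ℂ) := by
  simp [topShare, Matrix.mulVec, dotProduct]

theorem topShare_smul {n : Type*} [Fintype n] (j₀ : n) (A : Matrix n n ℝ) {c : ℝ} (hc : c ≠ 0) :
    topShare j₀ (c • A) = topShare j₀ A := by
  simp only [topShare, Matrix.smul_mulVec, Pi.smul_apply, smul_eq_mul, ← Finset.mul_sum]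
  exact mul_div_mul_left _ _ hc

theorem wordProd_smul {n Λ : Type*} [Fintype n] [DecidableEq n] (A : Λ → Matrix n n ℝ)
    (c : Λ → ℝ) {l : ℕ} (w : Fin l → Λ) :
    wordProd (fun i => c i • A i) w = (∏ k, c (w k)) • wordProd A w := by
  induction l with
  | zero => simp [wordProd_zero]
  | succ l ih =>
    rw [wordProd_succ, wordProd_succ, ih, Fin.prod_univ_succ, Matrix.smul_mul, Matrix.mul_smul,
      smul_smul]
    rfl

theorem projectivelyDiophantine_smul_iff {n Λ : Type*} [Fintype n] [DecidableEq n] (j₀ : n)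
    (A : Λ → Matrix n n ℝ) {c : Λ → ℝ} (hc : ∀ i, c i ≠ 0) :
    ProjectivelyDiophantine j₀ (fun i => c i • A i) ↔ ProjectivelyDiophantine j₀ A := by
  have h : ∀ {l : ℕ} (w : Fin l → Λ),
      topShare j₀ (wordProd (fun i => c i • A i) w) = topShare j₀ (wordProd A w) := fun w => by
    rw [wordProd_smul, topShare_smul _ _ (Finset.prod_ne_zero_iff.2 fun k _ => hc _)]
  simp only [ProjectivelyDiophantine, h]

/-! ### An invariant cone of complex vectors -/

/-- The complex vectors with nonzero coordinates whose arguments pairwise differ by at most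
`π / 4`. The condition is invariant under multiplication by complex scalars. -/
def InSector {n : Type*} (z : n → ℂ) : Prop :=
  (∀ j, z j ≠ 0) ∧ ∀ j k, |(z j * star (z k)).im| ≤ (z j * star (z k)).re

/-- An open condition on complex matrices, satisfied by the real matrices with positive entries,
which ensures that the cone `InSector` is preserved. -/
def NearlyPositive {n : Type*} (A : Matrix n n ℂ) : Prop :=
  ∃ a : ℝ, 0 < a ∧ ∀ j k p q, a ≤ (A j p * star (A k q)).re ∧
    |(A j p * star (A k q)).im| ≤ a / 2

theorem inSector_one {n : Type*} : InSector (1 : n → ℂ) := by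
  constructor <;> simp

theorem sum_im_mul_star {n : Type*} [Fintype n] (z : n → ℂ) :
    ∑ p, ∑ q, (z p * star (z q)).im = 0 := by
  have h : ∑ p, ∑ q, (z p * star (z q)) = (∑ p, z p) * star (∑ p, z p) := by
    rw [star_sum, Finset.sum_mul_sum]
  have h2 := congrArg Complex.im h
  simp only [Complex.im_sum] at h2
  rw [h2]
  simp [mul_comm]

theorem sum_re_mul_star {n : Type*} [Fintype n] (z : n → ℂ) :
    ∑ p, ∑ q, (z p * star (z q)).re = ‖∑ p, z p‖ ^ 2 := by
  have h : ∑ p, ∑ q, (z p * star (z q)) = (∑ p, z p) * star (∑ p, z p) := by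
    rw [star_sum, Finset.sum_mul_sum]
  have h2 := congrArg Complex.re h
  simp only [Complex.re_sum] at h2
  rw [h2, ← Complex.normSq_eq_norm_sq]
  simp [Complex.normSq_apply]

theorem InSector.re_nonneg {n : Type*} {z : n → ℂ} (hz : InSector z) (j k : n) :
    0 ≤ (z j * star (z k)).re := (abs_nonneg _).trans (hz.2 j k)

theorem InSector.norm_le_norm_sum {n : Type*} [Fintype n] {z : n → ℂ} (hz : InSector z) (j : n) :
    ‖z j‖ ≤ ‖∑ p, z p‖ := by
  have h1 : ‖z j‖ ^ 2 = (z j * star (z j)).re := by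
    rw [← Complex.normSq_eq_norm_sq]
    simp [Complex.normSq_apply]
  have h2 : ‖z j‖ ^ 2 ≤ ‖∑ p, z p‖ ^ 2 := by
    rw [h1, ← sum_re_mul_star]
    refine (Finset.single_le_sum (f := fun q => (z j * star (z q)).re)
      (fun q _ => hz.re_nonneg j q) (Finset.mem_univ j)).trans ?_
    exact Finset.single_le_sum (f := fun p => ∑ q, (z p * star (z q)).re)
      (fun p _ => Finset.sum_nonneg fun q _ => hz.re_nonneg p q) (Finset.mem_univ j)
  exact (pow_le_pow_iff_left₀ (norm_nonneg _) (norm_nonneg _) two_ne_zero).1 h2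

theorem InSector.sum_ne_zero {n : Type*} [Fintype n] [Nonempty n] {z : n → ℂ} (hz : InSector z) :
    ∑ p, z p ≠ 0 := by
  obtain ⟨j⟩ := ‹Nonempty n›
  exact norm_pos_iff.1 ((norm_pos_iff.2 (hz.1 j)).trans_le (hz.norm_le_norm_sum j))

theorem NearlyPositive.inSector_mulVec {n : Type*} [Fintype n] [Nonempty n] {A : Matrix n n ℂ}
    (hA : NearlyPositive A) {z : n → ℂ} (hz : InSector z) : InSector (A *ᵥ z) := by
  obtain ⟨a, ha, hA⟩ := hA
  have hS : 0 < ∑ p, ∑ q, (z p * star (z q)).re := by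
    rw [sum_re_mul_star]
    have := norm_pos_iff.2 hz.sum_ne_zero
    positivity
  have hexp : ∀ j k, (A *ᵥ z) j * star ((A *ᵥ z) k) =
      ∑ p, ∑ q, (A j p * star (A k q)) * (z p * star (z q)) := by
    intro j k
    simp only [Matrix.mulVec, dotProduct, star_sum, star_mul', Finset.sum_mul_sum]
    refine Finset.sum_congr rfl fun p _ => Finset.sum_congr rfl fun q _ => by ring
  have hre : ∀ j k, ∑ p, ∑ q, ((A j p * star (A k q)).re - |(A j p * star (A k q)).im|) *
      (z p * star (z q)).re ≤ ((A *ᵥ z) j * star ((A *ᵥ z) k)).re := by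
    intro j k
    rw [hexp]
    simp only [Complex.re_sum]
    refine Finset.sum_le_sum fun p _ => Finset.sum_le_sum fun q _ => ?_
    rw [Complex.mul_re (A j p * star (A k q))]
    have h1 := hz.2 p q
    have h2 : (A j p * star (A k q)).im * (z p * star (z q)).im ≤
        |(A j p * star (A k q)).im| * (z p * star (z q)).re := by
      refine (le_abs_self _).trans ?_
      rw [abs_mul]
      gcongr
    linarith
  have hlow : ∀ j k, a / 2 * ∑ p, ∑ q, (z p * star (z q)).re ≤
      ((A *ᵥ z) j * star ((A *ᵥ z) k)).re := by
    intro j k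
    refine le_trans ?_ (hre j k)
    simp only [Finset.mul_sum]
    refine Finset.sum_le_sum fun p _ => Finset.sum_le_sum fun q _ => ?_
    refine mul_le_mul_of_nonneg_right ?_ (hz.re_nonneg p q)
    linarith [(hA j k p q).1, (hA j k p q).2]
  -- Subtracting `a` from all coefficients does not change the imaginary part, since the
  -- imaginary parts of `z p * star (z q)` sum to zero; this is where strict positivity is used.
  have him : ∀ j k, |((A *ᵥ z) j * star ((A *ᵥ z) k)).im| ≤
      ∑ p, ∑ q, ((A j p * star (A k q)).re - a + |(A j p * star (A k q)).im|) *
        (z p * star (z q)).re := by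
    intro j k
    have e : ((A *ᵥ z) j * star ((A *ᵥ z) k)).im =
        ∑ p, ∑ q, (((A j p * star (A k q)).re - a) * (z p * star (z q)).im +
          (A j p * star (A k q)).im * (z p * star (z q)).re) := by
      rw [hexp]
      simp only [Complex.im_sum]
      have h0 : ∑ p, ∑ q, a * (z p * star (z q)).im = 0 := by
        simp only [← Finset.mul_sum]; rw [sum_im_mul_star, mul_zero]
      rw [← sub_zero (∑ p, ∑ q, _), ← h0, ← Finset.sum_sub_distrib]
      refine Finset.sum_congr rfl fun p _ => ?_
      rw [← Finset.sum_sub_distrib]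
      refine Finset.sum_congr rfl fun q _ => ?_
      rw [Complex.mul_im (A j p * star (A k q))]
      ring
    rw [e]
    refine (Finset.abs_sum_le_sum_abs _ _).trans (Finset.sum_le_sum fun p _ => ?_)
    refine (Finset.abs_sum_le_sum_abs _ _).trans (Finset.sum_le_sum fun q _ => ?_)
    refine (abs_add_le _ _).trans ?_
    rw [abs_mul, abs_mul, abs_of_nonneg (hz.re_nonneg p q),
      abs_of_nonneg (by linarith [(hA j k p q).1] : 0 ≤ (A j p * star (A k q)).re - a), add_mul]
    gcongr
    · linarith [(hA j k p q).1]
    · exact hz.2 p q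
  refine ⟨fun j h0 => ?_, fun j k => (him j k).trans (le_trans ?_ (hre j k))⟩
  · have := hlow j j
    rw [h0] at this
    simp only [zero_mul, Complex.zero_re] at this
    nlinarith
  · refine Finset.sum_le_sum fun p _ => Finset.sum_le_sum fun q _ => ?_
    refine mul_le_mul_of_nonneg_right ?_ (hz.re_nonneg p q)
    linarith [(hA j k p q).2]

theorem inSector_wordProd_mulVec_one {n Λ : Type*} [Fintype n] [DecidableEq n] [Nonempty n]
    {A : Λ → Matrix n n ℂ} (hA : ∀ i, NearlyPositive (A i)) {l : ℕ} (w : Fin l → Λ) :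
    InSector (wordProd A w *ᵥ 1) := by
  induction l with
  | zero => rw [wordProd_zero, Matrix.one_mulVec]; exact inSector_one
  | succ l ih =>
    rw [wordProd_succ, ← Matrix.mulVec_mulVec]
    exact (hA _).inSector_mulVec (ih _)

theorem norm_topShare_le_one {n Λ : Type*} [Fintype n] [DecidableEq n] (j₀ : n)
    {A : Λ → Matrix n n ℂ} (hA : ∀ i, NearlyPositive (A i)) {l : ℕ} (w : Fin l → Λ) :
    ‖topShare j₀ (wordProd A w)‖ ≤ 1 := by
  have : Nonempty n := ⟨j₀⟩
  rw [topShare, norm_div]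
  exact div_le_one_of_le₀ ((inSector_wordProd_mulVec_one hA w).norm_le_norm_sum j₀) (norm_nonneg _)

/-- Near a tuple of real matrices with positive entries, an affine complex line consists of
tuples of nearly positive matrices. -/
theorem eventually_nearlyPositive {n Λ : Type*} [Fintype n] [Finite Λ] (A E : Λ → Matrix n n ℝ)
    (s : ℝ) (h : ∀ i j k, 0 < A i j k + s * E i j k) :
    ∀ᶠ z : ℂ in 𝓝 (s : ℂ), ∀ i,
      NearlyPositive ((A i).map Complex.ofReal + z • (E i).map Complex.ofReal) := by
  refine eventually_all.2 fun i => ?_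
  rcases isEmpty_or_nonempty n with hn | hn
  · exact Eventually.of_forall fun z => ⟨1, one_pos, fun j => hn.elim j⟩
  obtain ⟨⟨j₁, k₁⟩, hmin⟩ := Finite.exists_min (fun p : n × n => A i p.1 p.2 + s * E i p.1 p.2)
  set b := A i j₁ k₁ + s * E i j₁ k₁ with hb
  have hb0 : 0 < b := h i j₁ k₁
  have key : ∀ j k p q, ∀ᶠ z : ℂ in 𝓝 (s : ℂ),
      b ^ 2 / 2 ≤ ((A i j p + z * E i j p) * star ((A i k q : ℂ) + z * E i k q)).re ∧
      |((A i j p + z * E i j p) * star ((A i k q : ℂ) + z * E i k q)).im| ≤ b ^ 2 / 2 / 2 := by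
    intro j k p q
    have hc : Continuous fun z : ℂ =>
        (A i j p + z * E i j p) * star ((A i k q : ℂ) + z * E i k q) := by fun_prop
    have hval : ((A i j p + (s : ℂ) * E i j p) * star ((A i k q : ℂ) + (s : ℂ) * E i k q)) =
        (((A i j p + s * E i j p) * (A i k q + s * E i k q) : ℝ) : ℂ) := by
      push_cast; simp
    have hge : b ^ 2 ≤ (A i j p + s * E i j p) * (A i k q + s * E i k q) := by
      have h1 : b ≤ A i j p + s * E i j p := hmin (j, p)
      have h2 : b ≤ A i k q + s * E i k q := hmin (k, q)
      rw [sq]; exact mul_le_mul h1 h2 hb0.le (hb0.le.trans h1)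
    have hb2 : 0 < b ^ 2 := by positivity
    refine Eventually.and ?_ ?_
    · refine ((Complex.continuous_re.comp hc).tendsto (s : ℂ)).eventually (Ici_mem_nhds ?_)
      simp only [Function.comp_apply]
      rw [hval, Complex.ofReal_re]; linarith
    · refine ((Complex.continuous_im.comp hc).abs.tendsto (s : ℂ)).eventually (Iic_mem_nhds ?_)
      simp only [Function.comp_apply]
      rw [hval, Complex.ofReal_im, abs_zero]; positivity
  have key' : ∀ᶠ z : ℂ in 𝓝 (s : ℂ), ∀ j k p q,
      b ^ 2 / 2 ≤ ((A i j p + z * E i j p) * star ((A i k q : ℂ) + z * E i k q)).re ∧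
      |((A i j p + z * E i j p) * star ((A i k q : ℂ) + z * E i k q)).im| ≤ b ^ 2 / 2 / 2 :=
    eventually_all.2 fun j => eventually_all.2 fun k => eventually_all.2 fun p =>
      eventually_all.2 fun q => key j k p q
  filter_upwards [key'] with z hz
  refine ⟨b ^ 2 / 2, by positivity, fun j k p q => ?_⟩
  simpa using hz j k p q

theorem differentiable_wordProd_mulVec {n Λ : Type*} [Fintype n] [DecidableEq n]
    (A E : Λ → Matrix n n ℂ) {l : ℕ} (w : Fin l → Λ) (j : n) :
    Differentiable ℂ fun z : ℂ => (wordProd (fun i => A i + z • E i) w *ᵥ 1) j := by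
  induction l generalizing j with
  | zero => simp [wordProd_zero]
  | succ l ih =>
    simp only [wordProd_succ, ← Matrix.mulVec_mulVec]
    have hmv : ∀ (B : Matrix n n ℂ) (y : n → ℂ), (B *ᵥ y) j = ∑ k, B j k * y k := fun _ _ => rfl
    simp only [hmv (_ + _)]
    refine Differentiable.fun_sum fun k _ => ?_
    refine Differentiable.mul ?_ (ih _ k)
    simp only [Matrix.add_apply, Matrix.smul_apply, smul_eq_mul]
    fun_prop

/-! ### Separation of the images of words with distinct first letters -/

theorem wordProd_mulVec_one_pos {n Λ : Type*} [Fintype n] [DecidableEq n] [Nonempty n]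
    {A : Λ → Matrix n n ℝ} (hA : ∀ i j k, 0 < A i j k) {l : ℕ} (w : Fin l → Λ) (j : n) :
    0 < (wordProd A w *ᵥ 1) j := by
  induction l generalizing j with
  | zero => simp [wordProd_zero]
  | succ l ih =>
    rw [wordProd_succ, ← Matrix.mulVec_mulVec]
    exact Finset.sum_pos (fun k _ => mul_pos (hA _ _ _) (ih _ k)) Finset.univ_nonempty

/-- The share of a coordinate in `A y` is a weighted mean of its shares in the columns of `A`. -/
theorem abs_topShare_mul_sub_le {n : Type*} [Fintype n] (j₀ : n) {A B : Matrix n n ℝ}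
    {q δ : ℝ} (hA : ∀ j k, 0 < A j k) (hB : ∀ j, 0 < (B *ᵥ 1) j)
    (h : ∀ k, |A j₀ k - q * ∑ j, A j k| ≤ δ * ∑ j, A j k) :
    |topShare j₀ (A * B) - q| ≤ δ := by
  have : Nonempty n := ⟨j₀⟩
  have hmv : ∀ (y : n → ℝ) (j : n), (A *ᵥ y) j = ∑ k, A j k * y k := fun _ _ => rfl
  have hs : ∑ j, (A *ᵥ (B *ᵥ 1)) j = ∑ k, (∑ j, A j k) * (B *ᵥ 1) k := by
    simp only [hmv, Finset.sum_mul]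
    exact Finset.sum_comm
  have hpos : 0 < ∑ j, (A *ᵥ (B *ᵥ 1)) j := Finset.sum_pos
    (fun j _ => Finset.sum_pos (fun k _ => mul_pos (hA _ _) (hB k)) Finset.univ_nonempty)
    Finset.univ_nonempty
  rw [topShare, ← Matrix.mulVec_mulVec, div_sub' hpos.ne', abs_div, abs_of_pos hpos,
    div_le_iff₀ hpos, hs, hmv, Finset.sum_mul, Finset.mul_sum, ← Finset.sum_sub_distrib]
  refine (Finset.abs_sum_le_sum_abs _ _).trans (Finset.sum_le_sum fun k _ => ?_)
  have e : A j₀ k * (B *ᵥ 1) k - (∑ j, A j k) * (B *ᵥ 1) k * q =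
      (A j₀ k - q * ∑ j, A j k) * (B *ᵥ 1) k := by ring
  rw [e, abs_mul, abs_of_pos (hB k), ← mul_assoc]
  exact mul_le_mul_of_nonneg_right (h k) (hB k).le

/-- If the columns of `E` all have the share `q` at `j₀`, then so do, approximately, the columns
of `A + s • E` for large `s`. -/
theorem eventually_abs_sub_le {n : Type*} [Fintype n] (j₀ : n) (A E : Matrix n n ℝ) {q δ : ℝ}
    (hδ : 0 < δ) (hE : ∀ k, 0 < ∑ j, E j k) (hq : ∀ k, E j₀ k = q * ∑ j, E j k) :
    ∀ᶠ s : ℝ in atTop, ∀ k,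
      |(A + s • E) j₀ k - q * ∑ j, (A + s • E) j k| ≤ δ * ∑ j, (A + s • E) j k := by
  refine eventually_all.2 fun k => ?_
  have h : Tendsto (fun s : ℝ => δ * (∑ j, A j k + s * ∑ j, E j k)) atTop atTop :=
    (tendsto_atTop_add_const_left _ _ (tendsto_id.atTop_mul_const (hE k))).const_mul_atTop hδ
  filter_upwards [h.eventually_ge_atTop |A j₀ k - q * ∑ j, A j k|] with s hs
  simp only [Matrix.add_apply, Matrix.smul_apply, smul_eq_mul, Finset.sum_add_distrib,
    ← Finset.mul_sum]
  have e : A j₀ k + s * E j₀ k - q * (∑ j, A j k + s * ∑ j, E j k) =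
      A j₀ k - q * ∑ j, A j k := by rw [hq k]; ring
  rw [e]; exact hs

/-- In the direction of positive matrices whose columns are projectively constant, with distinct
constants, words with distinct first letters are uniformly separated far out on each line. -/
theorem eventually_separated {n Λ : Type*} [Fintype n] [DecidableEq n] [Finite Λ] (j₀ : n)
    (A E : Λ → Matrix n n ℝ) (q : Λ → ℝ) (hqinj : Function.Injective q)
    (hE : ∀ i j k, 0 < E i j k) (hq : ∀ i k, E i j₀ k = q i * ∑ j, E i j k) :
    ∃ δ > 0, ∀ᶠ s : ℝ in atTop, (∀ i j k, 0 < A i j k + s * E i j k) ∧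
      ∀ (l : ℕ) (w w' : Fin (l + 1) → Λ), w 0 ≠ w' 0 →
        δ ≤ |topShare j₀ (wordProd (fun i => A i + s • E i) w) -
          topShare j₀ (wordProd (fun i => A i + s • E i) w')| := by
  have : Nonempty n := ⟨j₀⟩
  obtain ⟨δ, hδ, hδq⟩ : ∃ δ > 0, ∀ i i', i ≠ i' → 3 * δ ≤ |q i - q i'| := by
    have h : ∀ᶠ δ : ℝ in 𝓝[>] 0, ∀ i i', i ≠ i' → 3 * δ ≤ |q i - q i'| := by
      refine eventually_all.2 fun i => eventually_all.2 fun i' => ?_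
      by_cases hii : i = i'
      · exact Eventually.of_forall fun _ h => absurd hii h
      have hpos : 0 < |q i - q i'| := abs_pos.2 (sub_ne_zero.2 (hqinj.ne hii))
      have hc : Tendsto (fun δ : ℝ => 3 * δ) (𝓝 0) (𝓝 (3 * 0)) :=
        (continuous_const.mul continuous_id).tendsto 0
      rw [mul_zero] at hc
      filter_upwards [nhdsWithin_le_nhds (hc.eventually (Iic_mem_nhds hpos))] with δ h _ using h
    obtain ⟨δ, h1, h2⟩ := (h.and self_mem_nhdsWithin).exists
    exact ⟨δ, h2, h1⟩
  refine ⟨δ, hδ, ?_⟩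
  have hpos : ∀ᶠ s : ℝ in atTop, ∀ i j k, 0 < A i j k + s * E i j k := by
    refine eventually_all.2 fun i => eventually_all.2 fun j => eventually_all.2 fun k => ?_
    exact (tendsto_atTop_add_const_left _ _
      (tendsto_id.atTop_mul_const (hE i j k))).eventually_gt_atTop 0
  have hcol : ∀ᶠ s : ℝ in atTop, ∀ i k,
      |(A i + s • E i) j₀ k - q i * ∑ j, (A i + s • E i) j k| ≤
        δ * ∑ j, (A i + s • E i) j k :=
    eventually_all.2 fun i => eventually_abs_sub_le j₀ (A i) (E i) hδ
      (fun k => Finset.sum_pos (fun j _ => hE i j k) Finset.univ_nonempty) (hq i)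
  filter_upwards [hpos, hcol] with s hs hc
  refine ⟨hs, fun l w w' hw => ?_⟩
  have hs' : ∀ i j k, 0 < (A i + s • E i) j k := fun i j k => by simpa using hs i j k
  have hnear : ∀ u : Fin (l + 1) → Λ,
      |topShare j₀ (wordProd (fun i => A i + s • E i) u) - q (u 0)| ≤ δ := by
    intro u
    rw [wordProd_succ]
    exact abs_topShare_mul_sub_le j₀ (hs' _) (wordProd_mulVec_one_pos hs' _) (hc (u 0))
  have h1 := abs_le.1 (hnear w)
  have h2 := abs_le.1 (hnear w')
  have h3 := hδq _ _ hw
  rcases le_abs.1 h3 with h3 | h3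
  · exact le_abs.2 (Or.inl (by linarith))
  · exact le_abs.2 (Or.inr (by linarith))

/-! ### Almost every positive tuple is projectively Diophantine -/

/-- Almost every positive tuple on a line with direction `E` as in `eventually_separated` is
projectively Diophantine. -/
theorem ae_projectivelyDiophantine_line {n Λ : Type*} [Fintype n] [DecidableEq n] [Fintype Λ]
    (j₀ : n) (A E : Λ → Matrix n n ℝ) (q : Λ → ℝ) (hqinj : Function.Injective q)
    (hE : ∀ i j k, 0 < E i j k) (hq : ∀ i k, E i j₀ k = q i * ∑ j, E i j k) :
    ∀ᵐ s : ℝ, (∀ i j k, 0 < A i j k + s * E i j k) →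
      ProjectivelyDiophantine j₀ fun i => A i + s • E i := by
  classical
  have : Nonempty n := ⟨j₀⟩
  set I : Set ℝ := {s | ∀ i j k, 0 < A i j k + s * E i j k} with hIdef
  have hI : IsOpen I := by
    simp only [hIdef, Set.ofPred_forall]
    refine isOpen_iInter_of_finite fun i => isOpen_iInter_of_finite fun j =>
      isOpen_iInter_of_finite fun k => ?_
    exact isOpen_lt continuous_const (by fun_prop)
  have hIup : IsUpperSet I := by
    intro s t hst hs i j k
    have := mul_le_mul_of_nonneg_right hst (hE i j k).le
    linarith [hs i j k]
  obtain ⟨δ, hδ, hev⟩ := eventually_separated j₀ A E q hqinj hE hq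
  obtain ⟨s₀, hs₀, hsep⟩ := hev.exists
  let W : ℕ → Type _ := fun l =>
    {p : (Fin l → Λ) × (Fin l → Λ) // ∃ h : 0 < l, p.1 ⟨0, h⟩ ≠ p.2 ⟨0, h⟩}
  let C : ℂ → Λ → Matrix n n ℂ := fun z i =>
    (A i).map Complex.ofReal + z • (E i).map Complex.ofReal
  let f : ∀ l, W l → ℂ → ℂ := fun l p z =>
    topShare j₀ (wordProd (C z) p.1.1) - topShare j₀ (wordProd (C z) p.1.2)
  have hfreal : ∀ l (p : W l) (s : ℝ), f l p s =
      ((topShare j₀ (wordProd (fun i => A i + s • E i) p.1.1) -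
        topShare j₀ (wordProd (fun i => A i + s • E i) p.1.2) : ℝ) : ℂ) := by
    intro l p s
    have hC : C s = fun i => (A i + s • E i).map Complex.ofReal := by
      funext i; ext j k; simp [C]
    have hw : ∀ u : Fin l → Λ, wordProd (C s) u =
        (wordProd (fun i => A i + s • E i) u).map Complex.ofReal := by
      intro u
      rw [hC]
      exact (map_wordProd (Complex.ofRealHom.mapMatrix : Matrix n n ℝ →+* Matrix n n ℂ).toMonoidHom
        (fun i => A i + s • E i) u).symm
    simp only [f, hw, topShare_map_ofReal, Complex.ofReal_sub]
  have hmain := ae_exists_pow_lt_norm (W := W) (N := Fintype.card Λ * Fintype.card Λ)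
    (fun l => by
      refine (Fintype.card_subtype_le _).trans ?_
      simp [mul_pow])
    f hI hIup.ordConnected.isPreconnected 2
    (fun s hs => by
      obtain ⟨R, hR, hball⟩ := Metric.eventually_nhds_iff_ball.1
        (eventually_nearlyPositive A E s hs)
      refine ⟨R, hR, fun l p => ⟨fun z hz => DifferentiableAt.differentiableWithinAt ?_,
        fun z hz => ?_⟩⟩
      · have hd : ∀ u : Fin l → Λ,
            DifferentiableAt ℂ (fun z => topShare j₀ (wordProd (C z) u)) z := by
          intro u
          simp only [topShare]
          refine DifferentiableAt.fun_div
            (differentiable_wordProd_mulVec _ _ u j₀).differentiableAt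
            (DifferentiableAt.fun_sum fun j _ =>
              (differentiable_wordProd_mulVec _ _ u j).differentiableAt) ?_
          exact (inSector_wordProd_mulVec_one (hball z hz) u).sum_ne_zero
        exact (hd _).sub (hd _)
      · refine (norm_sub_le _ _).trans ?_
        linarith [norm_topShare_le_one j₀ (hball z hz) p.1.1,
          norm_topShare_le_one j₀ (hball z hz) p.1.2])
    hs₀ hδ
    (fun l p => by
      obtain ⟨⟨w, w'⟩, hl, hne⟩ := p
      obtain ⟨l, rfl⟩ : ∃ k, l = k + 1 := ⟨l - 1, by omega⟩
      rw [hfreal, Complex.norm_real, Real.norm_eq_abs]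
      exact hsep l w w' hne)
  filter_upwards [hmain] with s hs hsI
  obtain ⟨c, hc, h⟩ := hs hsI
  refine ⟨c, hc, fun l w w' hw => ?_⟩
  have := h (l + 1) (by omega) ⟨(w, w'), by omega, hw⟩
  rwa [hfreal, Complex.norm_real, Real.norm_eq_abs] at this

theorem continuous_wordProd_toTuple {d m : ℕ} {l : ℕ} (w : Fin l → Fin m) :
    Continuous fun a : TupleSpace d m => wordProd (toTuple a) w := by
  induction l with
  | zero => simp only [wordProd_zero]; exact continuous_const
  | succ l ih =>
    simp only [wordProd_succ]
    refine Continuous.matrix_mul ?_ (ih _)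
    refine continuous_matrix fun j k => ?_
    simp only [toTuple, Matrix.of_apply]
    fun_prop

theorem measurable_topShare_wordProd {d m : ℕ} (j₀ : Fin d) {l : ℕ} (w : Fin l → Fin m) :
    Measurable fun a : TupleSpace d m => topShare j₀ (wordProd (toTuple a) w) := by
  have h : ∀ j, Continuous fun a : TupleSpace d m => (wordProd (toTuple a) w *ᵥ 1) j := fun j =>
    (continuous_apply j).comp ((continuous_wordProd_toTuple w).matrix_mulVec continuous_const)
  exact (h j₀).measurable.div (continuous_finsetSum _ fun j _ => h j).measurable

theorem projectivelyDiophantine_iff_exists_nat {n Λ : Type*} [Fintype n] [DecidableEq n] (j₀ : n)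
    (A : Λ → Matrix n n ℝ) :
    ProjectivelyDiophantine j₀ A ↔ ∃ k : ℕ, ∀ (l : ℕ) (w w' : Fin (l + 1) → Λ), w 0 ≠ w' 0 →
      (1 / ((k : ℝ) + 1)) ^ (l + 1) <
        |topShare j₀ (wordProd A w) - topShare j₀ (wordProd A w')| := by
  constructor
  · rintro ⟨c, hc, h⟩
    obtain ⟨k, hk⟩ := exists_nat_one_div_lt hc
    exact ⟨k, fun l w w' hw => (pow_le_pow_left₀ (by positivity) hk.le _).trans_lt (h l w w' hw)⟩
  · rintro ⟨k, h⟩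
    exact ⟨_, by positivity, h⟩

theorem measurableSet_projectivelyDiophantine {d m : ℕ} (j₀ : Fin d) :
    MeasurableSet {a : TupleSpace d m | ProjectivelyDiophantine j₀ (toTuple a)} := by
  simp only [projectivelyDiophantine_iff_exists_nat, Set.ofPred_exists, Set.ofPred_forall]
  refine MeasurableSet.iUnion fun k => MeasurableSet.iInter fun l => MeasurableSet.iInter fun w =>
    MeasurableSet.iInter fun w' => MeasurableSet.iInter fun _ => ?_
  exact measurableSet_lt measurable_const
    (((measurable_topShare_wordProd j₀ w).sub (measurable_topShare_wordProd j₀ w')).norm)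

theorem measurableSet_positiveEntries {d m : ℕ} :
    MeasurableSet {a : TupleSpace d m | ∀ i, PositiveEntries (toTuple a i)} := by
  simp only [PositiveEntries, Set.ofPred_forall, toTuple, Matrix.of_apply]
  refine MeasurableSet.iInter fun i => MeasurableSet.iInter fun j => MeasurableSet.iInter fun k => ?_
  exact measurableSet_lt measurable_const (by fun_prop)

/-- Almost every tuple of positive matrices is projectively Diophantine. By Fubini it is enough to
consider lines in one fixed direction, whose `i`-th matrix has rank one, with first row
constant equal to `i + 1` and all other entries `1`. -/
theorem ae_projectivelyDiophantine {d m : ℕ} (hd : 2 ≤ d) (j₀ : Fin d) :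
    ∀ᵐ a : TupleSpace d m, (∀ i, PositiveEntries (toTuple a i)) →
      ProjectivelyDiophantine j₀ (toTuple a) := by
  let e : TupleSpace d m := WithLp.toLp 2 fun x => if x.2.1 = j₀ then (x.1 : ℝ) + 1 else 1
  let q : Fin m → ℝ := fun i => ((i : ℝ) + 1) / ((i : ℝ) + d)
  have hd' : (2 : ℝ) ≤ d := by exact_mod_cast hd
  have hsum : ∀ (i : Fin m) (k : Fin d), ∑ j, toTuple e i j k = (i : ℝ) + d := by
    intro i k
    have h1 : ∀ j, toTuple e i j k = 1 + if j = j₀ then (i : ℝ) else 0 := by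
      intro j
      by_cases hj : j = j₀ <;> simp [toTuple, e, hj, add_comm]
    simp only [h1, Finset.sum_add_distrib, Finset.sum_ite_eq', Finset.mem_univ, if_true]
    simp [add_comm]
  have key := ae_mem_of_ae_add_linearMap_mem (LinearMap.toSpanSingleton ℝ (TupleSpace d m) e)
    volume volume
    (s := {a | (∀ i, PositiveEntries (toTuple a i)) → ProjectivelyDiophantine j₀ (toTuple a)})
    (by
      have : {a : TupleSpace d m | (∀ i, PositiveEntries (toTuple a i)) →
          ProjectivelyDiophantine j₀ (toTuple a)} =
          {a | ∀ i, PositiveEntries (toTuple a i)}ᶜ ∪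
            {a | ProjectivelyDiophantine j₀ (toTuple a)} := by
        ext a; simp only [Set.mem_ofPred_eq, Set.mem_union, Set.mem_compl_iff, imp_iff_not_or]
      rw [this]
      exact measurableSet_positiveEntries.compl.union (measurableSet_projectivelyDiophantine j₀))
    (by
      intro a
      have hline : ∀ s : ℝ, toTuple (a + LinearMap.toSpanSingleton ℝ (TupleSpace d m) e s) =
          fun i => toTuple a i + s • toTuple e i := by
        intro s; funext i; ext j k; simp [toTuple]
      have := ae_projectivelyDiophantine_line j₀ (toTuple a) (toTuple e) q
        (by
          intro i i' h
          have h1 : ((i : ℝ) + d) ≠ 0 := by positivity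
          have h2 : ((i' : ℝ) + d) ≠ 0 := by positivity
          simp only [q] at h
          rw [div_eq_div_iff h1 h2] at h
          have h3 : ((i : ℝ) - i') * (d - 1) = 0 := by linarith
          have h4 : (d : ℝ) - 1 ≠ 0 := by linarith
          have h5 : (i : ℝ) = i' := by
            rcases mul_eq_zero.1 h3 with h | h
            · linarith
            · exact absurd h h4
          exact Fin.ext (by exact_mod_cast h5))
        (by
          intro i j k
          by_cases hj : j = j₀ <;> simp [toTuple, e, hj]
          positivity)
        (by
          intro i k
          rw [hsum]
          have h1 : ((i : ℝ) + d) ≠ 0 := by positivity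
          simp only [q]
          rw [div_mul_cancel₀ _ h1]
          simp [toTuple, e])
      filter_upwards [this] with s hs
      simp only [hline]
      intro hpos
      exact hs fun i j k => by simpa using hpos i j k)
  exact key

/-! ### From projective to norm separation -/

theorem opDist_nonneg {d : ℕ} (A B : Matrix (Fin d) (Fin d) ℝ) : 0 ≤ opDist A B := norm_nonneg _

theorem opDist_mul_mul_le {d : ℕ} (P Q A B : Matrix (Fin d) (Fin d) ℝ) :
    opDist (P * A * Q) (P * B * Q) ≤
      ‖Matrix.toEuclideanCLM (n := Fin d) (𝕜 := ℝ) P‖ *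
        ‖Matrix.toEuclideanCLM (n := Fin d) (𝕜 := ℝ) Q‖ * opDist A B := by
  have h : P * A * Q - P * B * Q = P * (A - B) * Q := by
    rw [Matrix.mul_sub, Matrix.sub_mul]
  rw [opDist, opDist, h, map_mul, map_mul]
  refine (norm_mul_le _ _).trans ?_
  refine (mul_le_mul_of_nonneg_right (norm_mul_le _ _) (norm_nonneg _)).trans (le_of_eq ?_)
  ring

theorem abs_mulVec_sub_le_opDist {d : ℕ} (A B : Matrix (Fin d) (Fin d) ℝ) (x : Fin d → ℝ)
    (j : Fin d) : |(A *ᵥ x) j - (B *ᵥ x) j| ≤ opDist A B * ‖WithLp.toLp 2 x‖ := by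
  have h1 := (Matrix.toEuclideanCLM (n := Fin d) (𝕜 := ℝ) (A - B)).le_opNorm (WithLp.toLp 2 x)
  rw [Matrix.toEuclideanCLM_toLp] at h1
  have h2 := PiLp.norm_apply_le (WithLp.toLp 2 ((A - B) *ᵥ x)) j
  refine le_trans (le_of_eq ?_) (h2.trans h1)
  simp [Matrix.sub_mulVec]

/-- Multiplicative constants can be absorbed into the base of a power of positive exponent. -/
theorem div_pow_lt_of_pow_lt_mul {c K D : ℝ} (hc : 0 < c) (hK : 1 ≤ K) {n : ℕ} (hn : n ≠ 0)
    (h : c ^ n < K * D) : (c / K) ^ n < D := by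
  have hK0 : 0 < K := by linarith
  rw [div_pow, div_lt_iff₀ (by positivity)]
  have h1 : K ≤ K ^ n := le_self_pow₀ hK hn
  have hD : 0 < D := by
    have : 0 < K * D := (pow_pos hc n).trans h
    exact pos_of_mul_pos_right this hK0.le
  nlinarith

theorem abs_div_sub_div_le {x x' S S' : ℝ} (hS : 0 < S) (hx' : 0 ≤ x') (hxS : x' ≤ S') :
    |x / S - x' / S'| ≤ (|x - x'| + |S - S'|) / S := by
  rcases (hx'.trans hxS).eq_or_lt with h0 | hS'
  · have : x' = 0 := le_antisymm (h0 ▸ hxS) hx'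
    rw [this, zero_div, sub_zero, sub_zero, abs_div, abs_of_pos hS]
    gcongr
    linarith [abs_nonneg (S - S')]
  have e : x / S - x' / S' = (x - x') / S - x' / S' * ((S - S') / S) := by
    field_simp; ring
  have hr : |x' / S'| ≤ 1 := by
    rw [abs_of_nonneg (by positivity)]; exact div_le_one_of_le₀ hxS hS'.le
  rw [e, add_div]
  refine (abs_sub _ _).trans ?_
  rw [abs_mul, abs_div, abs_div (S - S'), abs_of_pos hS]
  have : |x' / S'| * (|S - S'| / S) ≤ 1 * (|S - S'| / S) := by gcongr
  linarith

theorem exists_pos_forall_le {n Λ : Type*} [Finite n] [Finite Λ] {A : Λ → Matrix n n ℝ}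
    (hA : ∀ i j k, 0 < A i j k) : ∃ τ > 0, ∀ i j k, τ ≤ A i j k := by
  have h : ∀ᶠ τ : ℝ in 𝓝[>] 0, ∀ i j k, τ ≤ A i j k :=
    eventually_all.2 fun i => eventually_all.2 fun j => eventually_all.2 fun k =>
      nhdsWithin_le_nhds (Iic_mem_nhds (hA i j k))
  obtain ⟨τ, h1, h2⟩ := (h.and self_mem_nhdsWithin).exists
  exact ⟨τ, h2, h1⟩

theorem pow_le_sum_wordProd_mulVec_one {n Λ : Type*} [Fintype n] [DecidableEq n] [Nonempty n]
    {A : Λ → Matrix n n ℝ} {τ : ℝ} (hτ : 0 < τ) (hA : ∀ i j k, τ ≤ A i j k) {l : ℕ}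
    (w : Fin l → Λ) : τ ^ l ≤ ∑ j, (wordProd A w *ᵥ 1) j := by
  induction l with
  | zero =>
    simp only [wordProd_zero, Matrix.one_mulVec, pow_zero, Pi.one_apply, Finset.sum_const,
      nsmul_eq_mul, mul_one, Finset.card_univ]
    exact_mod_cast Fintype.card_pos
  | succ l ih =>
    obtain ⟨j₁⟩ := ‹Nonempty n›
    have : Nonempty n := ⟨j₁⟩
    have hpos : ∀ (u : Fin l → Λ) k, 0 < (wordProd A u *ᵥ 1) k :=
      wordProd_mulVec_one_pos fun i j k => hτ.trans_le (hA i j k)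
    have hmv : ∀ i (y : n → ℝ) (j : n), (A i *ᵥ y) j = ∑ k, A i j k * y k := fun _ _ _ => rfl
    rw [wordProd_succ, ← Matrix.mulVec_mulVec, pow_succ']
    calc τ * τ ^ l ≤ τ * ∑ k, (wordProd A (Fin.tail w) *ᵥ 1) k := by
          gcongr; exact ih _
      _ ≤ (A (w 0) *ᵥ (wordProd A (Fin.tail w) *ᵥ 1)) j₁ := by
          rw [hmv, Finset.mul_sum]
          exact Finset.sum_le_sum fun k _ => mul_le_mul_of_nonneg_right (hA _ _ _) (hpos _ k).le
      _ ≤ _ := by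
          refine Finset.single_le_sum (f := fun j =>
            (A (w 0) *ᵥ (wordProd A (Fin.tail w) *ᵥ 1)) j) (fun j _ => ?_) (Finset.mem_univ j₁)
          rw [hmv]
          exact Finset.sum_nonneg fun k _ => mul_nonneg (hτ.le.trans (hA _ _ _)) (hpos _ k).le

/-- Projectively separated products of positive matrices are separated in norm, since their
entries are at least exponentially small. -/
theorem ProjectivelyDiophantine.exists_pow_lt_opDist {d m : ℕ} {j₀ : Fin d}
    {A : Fin m → Matrix (Fin d) (Fin d) ℝ} (h : ProjectivelyDiophantine j₀ A)
    (hA : ∀ i, PositiveEntries (A i)) :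
    ∃ c : ℝ, 0 < c ∧ ∀ (l : ℕ) (w w' : Fin (l + 1) → Fin m), w 0 ≠ w' 0 →
      c ^ (l + 1) < opDist (wordProd A w) (wordProd A w') := by
  have : Nonempty (Fin d) := ⟨j₀⟩
  obtain ⟨c, hc, h⟩ := h
  obtain ⟨τ, hτ, hτA⟩ := exists_pos_forall_le hA
  set N := ‖WithLp.toLp 2 (1 : Fin d → ℝ)‖ with hN
  have hN0 : 0 ≤ N := norm_nonneg _
  have hK : 1 ≤ 1 + (1 + d) * N := by
    have : 0 ≤ (1 + (d : ℝ)) * N := by positivity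
    linarith
  refine ⟨c * τ / (1 + (1 + d) * N), by positivity, fun l w w' hw => ?_⟩
  refine div_pow_lt_of_pow_lt_mul (by positivity) hK l.succ_ne_zero ?_
  have hlt := h l w w' hw
  set D := opDist (wordProd A w) (wordProd A w') with hD
  have hD0 : 0 ≤ D := opDist_nonneg _ _
  have hS := pow_le_sum_wordProd_mulVec_one hτ hτA w
  have hSpos : 0 < ∑ j, (wordProd A w *ᵥ 1) j := (by positivity : 0 < τ ^ (l + 1)).trans_le hS
  have hpos' : ∀ j, 0 < (wordProd A w' *ᵥ 1) j := wordProd_mulVec_one_pos hA w'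
  have hsh := hlt.trans_le (abs_div_sub_div_le hSpos (hpos' j₀).le
    (Finset.single_le_sum (f := fun j => (wordProd A w' *ᵥ 1) j)
      (fun j _ => (hpos' j).le) (Finset.mem_univ j₀)))
  rw [lt_div_iff₀ hSpos] at hsh
  have h1 : |(wordProd A w *ᵥ 1) j₀ - (wordProd A w' *ᵥ 1) j₀| ≤ D * N :=
    abs_mulVec_sub_le_opDist _ _ _ _
  have h2 : |∑ j, (wordProd A w *ᵥ 1) j - ∑ j, (wordProd A w' *ᵥ 1) j| ≤ d * (D * N) := by
    rw [← Finset.sum_sub_distrib]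
    refine (Finset.abs_sum_le_sum_abs _ _).trans ?_
    refine (Finset.sum_le_sum fun j _ => abs_mulVec_sub_le_opDist _ _ _ j).trans (le_of_eq ?_)
    simp [hD, hN]
  rw [mul_pow]
  have h3 : c ^ (l + 1) * τ ^ (l + 1) ≤ c ^ (l + 1) * ∑ j, (wordProd A w *ᵥ 1) j := by gcongr
  nlinarith

/-- Words with a common first letter are handled by cancelling it, at the cost of a factor
bounded in terms of the inverses of the matrices. -/
theorem stronglyDiophantine_of_exists_pow_lt {d m : ℕ} {A : Fin m → Matrix (Fin d) (Fin d) ℝ}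
    (hdet : ∀ i, (A i).det ≠ 0)
    (h : ∃ c : ℝ, 0 < c ∧ ∀ (l : ℕ) (w w' : Fin (l + 1) → Fin m), w 0 ≠ w' 0 →
      c ^ (l + 1) < opDist (wordProd A w) (wordProd A w')) :
    StronglyDiophantine opDist A := by
  obtain ⟨c, hc, h⟩ := h
  obtain ⟨K, hK1, hK⟩ : ∃ K : ℝ, 1 ≤ K ∧ ∀ i X Y, opDist X Y ≤ K * opDist (A i * X) (A i * Y) := by
    obtain ⟨K, hK⟩ := (Set.finite_range fun i => ‖Matrix.toEuclideanCLM (n := Fin d) (𝕜 := ℝ)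
      (A i)⁻¹‖ * ‖Matrix.toEuclideanCLM (n := Fin d) (𝕜 := ℝ) 1‖).bddAbove
    refine ⟨max 1 K, le_max_left _ _, fun i X Y => ?_⟩
    have h1 := opDist_mul_mul_le (A i)⁻¹ 1 (A i * X) (A i * Y)
    rw [Matrix.mul_one, Matrix.mul_one, Matrix.nonsing_inv_mul_cancel_left _ _ (hdet i).isUnit,
      Matrix.nonsing_inv_mul_cancel_left _ _ (hdet i).isUnit] at h1
    refine h1.trans (mul_le_mul_of_nonneg_right ?_ (opDist_nonneg _ _))
    exact (hK ⟨i, rfl⟩).trans (le_max_right _ _)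
  have hK0 : 0 < K := by linarith
  refine ⟨min c 1 / K, by positivity, fun n => ?_⟩
  induction n with
  | zero => exact fun w w' hw => absurd (Subsingleton.elim w w') hw
  | succ n ih =>
    intro w w' hw
    by_cases h0 : w 0 = w' 0
    · have ht : Fin.tail w ≠ Fin.tail w' := by
        intro ht
        apply hw
        rw [← Fin.cons_self_tail w, ← Fin.cons_self_tail w', h0, ht]
      have h1 := ih _ _ ht
      have h2 := hK (w 0) (wordProd A (Fin.tail w)) (wordProd A (Fin.tail w'))
      rw [wordProd_succ, wordProd_succ, ← h0, pow_succ]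
      have h3 : (min c 1 / K) ^ n * (min c 1 / K) ≤ (min c 1 / K) ^ n * (1 / K) := by
        gcongr; exact min_le_right _ _
      refine h3.trans_lt ?_
      rw [mul_one_div, div_lt_iff₀ hK0]
      linarith
    · have := h n w w' h0
      refine lt_of_le_of_lt (pow_le_pow_left₀ (by positivity) ?_ _) this
      exact (div_le_self (by positivity) hK1).trans (min_le_left _ _)

theorem ProjectivelyDiophantine.stronglyDiophantine {d m : ℕ} {j₀ : Fin d}
    {A : Fin m → Matrix (Fin d) (Fin d) ℝ} (h : ProjectivelyDiophantine j₀ A)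
    (hA : ∀ i, PositiveEntries (A i)) (hdet : ∀ i, (A i).det ≠ 0) :
    StronglyDiophantine opDist A :=
  stronglyDiophantine_of_exists_pow_lt hdet (h.exists_pow_lt_opDist hA)

/-! ### Reduction from simplicial cones to positive matrices -/

theorem wordProd_conj {n Λ : Type*} [Fintype n] [DecidableEq n] {P Q : Matrix n n ℝ}
    (hQP : Q * P = 1) (hPQ : P * Q = 1) (A : Λ → Matrix n n ℝ) {l : ℕ} (w : Fin l → Λ) :
    wordProd (fun i => P * A i * Q) w = P * wordProd A w * Q := by
  induction l with
  | zero => simp [wordProd_zero, hPQ]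
  | succ l ih =>
    rw [wordProd_succ, wordProd_succ, ih]
    calc P * A (w 0) * Q * (P * wordProd A (Fin.tail w) * Q)
        = P * A (w 0) * (Q * P) * wordProd A (Fin.tail w) * Q := by simp only [Matrix.mul_assoc]
      _ = _ := by rw [hQP]; simp only [Matrix.mul_assoc, Matrix.one_mul]

theorem StronglyDiophantine.of_conj {d m : ℕ} {P Q : Matrix (Fin d) (Fin d) ℝ}
    (hQP : Q * P = 1) (hPQ : P * Q = 1) {A : Fin m → Matrix (Fin d) (Fin d) ℝ}
    (h : StronglyDiophantine opDist fun i => P * A i * Q) : StronglyDiophantine opDist A := by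
  obtain ⟨c, hc, h⟩ := h
  set K := ‖Matrix.toEuclideanCLM (n := Fin d) (𝕜 := ℝ) P‖ *
    ‖Matrix.toEuclideanCLM (n := Fin d) (𝕜 := ℝ) Q‖
  refine ⟨c / max 1 K, by positivity, fun n w w' hw => ?_⟩
  have hn : n ≠ 0 := by rintro rfl; exact hw (Subsingleton.elim _ _)
  refine div_pow_lt_of_pow_lt_mul hc (le_max_left _ _) hn ((h n w w' hw).trans_le ?_)
  rw [wordProd_conj hQP hPQ, wordProd_conj hQP hPQ]
  exact (opDist_mul_mul_le P Q _ _).trans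
    (mul_le_mul_of_nonneg_right (le_max_right _ _) (opDist_nonneg _ _))

/-- The matrix with columns `v i`. -/
def colMatrix {d : ℕ} (v : Fin d → Fin d → ℝ) : Matrix (Fin d) (Fin d) ℝ :=
  (Matrix.of v)ᵀ

theorem colMatrix_mulVec {d : ℕ} (v : Fin d → Fin d → ℝ) (x : Fin d → ℝ) :
    colMatrix v *ᵥ x = ∑ i, x i • v i := by
  ext j
  simp [colMatrix, Matrix.mulVec, dotProduct, mul_comm]

theorem isUnit_det_colMatrix {d : ℕ} {v : Fin d → Fin d → ℝ} (hv : LinearIndependent ℝ v) :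
    IsUnit (colMatrix v).det := by
  rw [colMatrix, Matrix.det_transpose, ← Matrix.isUnit_iff_isUnit_det]
  exact Matrix.linearIndependent_rows_iff_isUnit.1 hv

theorem inv_colMatrix_mulVec_pos {d : ℕ} {v : Fin d → Fin d → ℝ} (hv : LinearIndependent ℝ v)
    {y : Fin d → ℝ} (hy : y ∈ interior (coneSpan v)) (i : Fin d) :
    0 < ((colMatrix v)⁻¹ *ᵥ y) i := by
  have hu := isUnit_det_colMatrix hv
  -- Moving from `y` slightly in the direction `-v i` stays inside the cone.
  have hc : Tendsto (fun t : ℝ => y - t • v i) (𝓝[>] 0) (𝓝 y) := by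
    have : Continuous fun t : ℝ => y - t • v i := by fun_prop
    have h := this.tendsto 0
    simp only [zero_smul, sub_zero] at h
    exact h.mono_left nhdsWithin_le_nhds
  obtain ⟨t, ⟨x, hx, hxy⟩, ht⟩ :=
    ((hc.eventually (mem_interior_iff_mem_nhds.1 hy)).and self_mem_nhdsWithin).exists
  have ht0 : 0 < t := ht
  have h1 : v i = colMatrix v *ᵥ Pi.single i 1 := by
    rw [colMatrix_mulVec]
    simp [Pi.single_apply]
  have h2 : y = colMatrix v *ᵥ (x + t • Pi.single i 1) := by
    rw [Matrix.mulVec_add, Matrix.mulVec_smul, ← h1, colMatrix_mulVec, ← hxy]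
    simp
  rw [h2, Matrix.mulVec_mulVec, Matrix.nonsing_inv_mul _ hu, Matrix.one_mulVec]
  simp only [Pi.add_apply, Pi.smul_apply, Pi.single_eq_same, smul_eq_mul, mul_one]
  linarith [hx i]

/-- In the basis `v`, matrices leaving the cone over `v` strictly invariant have positive
entries. -/
theorem StrictlyInvariant.positiveEntries_conj {d : ℕ} {v : Fin d → Fin d → ℝ}
    (hv : LinearIndependent ℝ v) {A : Matrix (Fin d) (Fin d) ℝ}
    (hA : StrictlyInvariant (coneSpan v) A) :
    PositiveEntries ((colMatrix v)⁻¹ * A * colMatrix v) := by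
  intro i k
  have hvk : colMatrix v *ᵥ Pi.single k 1 = v k := by
    rw [colMatrix_mulVec]
    simp [Pi.single_apply]
  have hmem : v k ∈ coneSpan v \ {0} := by
    refine ⟨⟨Pi.single k 1, fun i => ?_, ?_⟩, hv.ne_zero k⟩
    · by_cases h : i = k
      · subst h; simp
      · simp [h]
    · rw [← colMatrix_mulVec, hvk]
  have h := inv_colMatrix_mulVec_pos hv (hA _ hmem) i
  rw [← hvk, Matrix.mulVec_mulVec, Matrix.mulVec_mulVec, Matrix.mulVec_single_one] at h
  exact h

/-- The linear map sending a tuple `(A_i)` to `(P A_i Q)`. -/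
def mulTuple {d : ℕ} (m : ℕ) (P Q : Matrix (Fin d) (Fin d) ℝ) :
    TupleSpace d m →ₗ[ℝ] TupleSpace d m where
  toFun a := WithLp.toLp 2 fun x => (P * toTuple a x.1 * Q) x.2.1 x.2.2
  map_add' a b := by
    ext x
    have : toTuple (a + b) x.1 = toTuple a x.1 + toTuple b x.1 := by ext j k; simp [toTuple]
    simp [this, Matrix.mul_add, Matrix.add_mul]
  map_smul' c a := by
    ext x
    have : toTuple (c • a) x.1 = c • toTuple a x.1 := by ext j k; simp [toTuple]
    simp [this]

theorem toTuple_mulTuple {d m : ℕ} (P Q : Matrix (Fin d) (Fin d) ℝ) (a : TupleSpace d m)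
    (i : Fin m) : toTuple (mulTuple m P Q a) i = P * toTuple a i * Q := by
  ext j k; simp [toTuple, mulTuple]

theorem toTuple_injective {d m : ℕ} : Function.Injective (toTuple : TupleSpace d m → _) := by
  intro a b h
  ext ⟨i, j, k⟩
  exact congrFun (congrFun (congrFun h i) j) k

/-- The tuples of positive matrices that are not projectively Diophantine. -/
def exceptionalTuples {d : ℕ} (m : ℕ) (j₀ : Fin d) : Set (TupleSpace d m) :=
  {a | (∀ i, PositiveEntries (toTuple a i)) ∧ ¬ ProjectivelyDiophantine j₀ (toTuple a)}

theorem volume_exceptionalTuples {d m : ℕ} (hd : 2 ≤ d) (j₀ : Fin d) :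
    volume (exceptionalTuples m j₀) = 0 := by
  refine measure_mono_null (fun a ha => ?_) (ae_iff.1 (ae_projectivelyDiophantine hd j₀))
  exact fun h => ha.2 (h ha.1)

/-- A tuple for which a simplicial cone is strictly invariant and which is not strongly
Diophantine is conjugate to an exceptional tuple of positive matrices. -/
theorem exists_mem_exceptionalTuples {d m : ℕ} (j₀ : Fin d) {v : Fin d → Fin d → ℝ}
    (hv : LinearIndependent ℝ v) {a : TupleSpace d m} (hdet : ∀ i, (toTuple a i).det ≠ 0)
    (hinv : ∀ i, StrictlyInvariant (coneSpan v) (toTuple a i))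
    (ha : ¬ StronglyDiophantine opDist (toTuple a)) :
    ∃ b ∈ exceptionalTuples m j₀, (∀ i, (toTuple b i).det = (toTuple a i).det) ∧
      mulTuple m (colMatrix v) (colMatrix v)⁻¹ b = a := by
  have hu := isUnit_det_colMatrix hv
  have hVV := Matrix.mul_nonsing_inv _ hu
  have hVV' := Matrix.nonsing_inv_mul _ hu
  set V := colMatrix v
  have hb : toTuple (mulTuple m V⁻¹ V a) = fun i => V⁻¹ * toTuple a i * V :=
    funext fun i => toTuple_mulTuple _ _ _ _
  have hbdet : ∀ i, (V⁻¹ * toTuple a i * V).det = (toTuple a i).det := by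
    intro i
    rw [Matrix.det_mul, Matrix.det_mul, mul_right_comm, ← Matrix.det_mul, hVV', Matrix.det_one,
      one_mul]
  have hbpos : ∀ i, PositiveEntries (V⁻¹ * toTuple a i * V) :=
    fun i => (hinv i).positiveEntries_conj hv
  refine ⟨mulTuple m V⁻¹ V a, ⟨fun i => by rw [hb]; exact hbpos i, fun hP => ha ?_⟩,
    fun i => by rw [hb]; exact hbdet i, toTuple_injective (funext fun i => ?_)⟩
  · rw [hb] at hP
    exact (hP.stronglyDiophantine hbpos fun i => by rw [hbdet]; exact hdet i).of_conj hVV hVV'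
  · rw [toTuple_mulTuple, hb]
    calc V * (V⁻¹ * toTuple a i * V) * V⁻¹ = (V * V⁻¹) * toTuple a i * (V * V⁻¹) := by
          simp only [Matrix.mul_assoc]
      _ = _ := by rw [hVV, Matrix.one_mul, Matrix.mul_one]

/-! ### Exceptional tuples of determinant one -/

theorem hausdorffMeasure_image_eq_zero_of_contDiffAt {X Y : Type*} [NormedAddCommGroup X]
    [NormedSpace ℝ X] [MeasurableSpace X] [BorelSpace X] [SecondCountableTopology X]
    [NormedAddCommGroup Y] [NormedSpace ℝ Y] [MeasurableSpace Y] [BorelSpace Y] {s : ℝ}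
    (hs : 0 ≤ s) {f : X → Y} {N : Set X} (hf : ∀ x ∈ N, ContDiffAt ℝ 1 f x)
    (hN : μH[s] N = 0) : μH[s] (f '' N) = 0 := by
  choose! K t ht hK using fun x hx => (hf x hx).exists_lipschitzOnWith
  obtain ⟨S, hSN, hS, hcov⟩ := TopologicalSpace.countable_cover_nhdsWithin (f := t) (s := N)
    fun x hx => mem_nhdsWithin_of_mem_nhds (ht x hx)
  have hsub : f '' N ⊆ ⋃ x ∈ S, f '' (t x ∩ N) := by
    rintro _ ⟨y, hy, rfl⟩
    obtain ⟨x, hx, hyx⟩ := Set.mem_iUnion₂.1 (hcov hy)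
    exact Set.mem_iUnion₂.2 ⟨x, hx, y, ⟨hyx, hy⟩, rfl⟩
  refine measure_mono_null hsub ((measure_biUnion_null_iff hS).2 fun x hx => ?_)
  have h := ((hK x (hSN hx)).mono (Set.inter_subset_left (t := N))).hausdorffMeasure_image_le hs
  rw [measure_mono_null Set.inter_subset_right hN, mul_zero] at h
  exact le_antisymm h (zero_le)

/-- The positions, in a tuple of matrices, other than the diagonal entry `j₀` of each matrix. -/
abbrev OffCorner {d : ℕ} (m : ℕ) (j₀ : Fin d) : Type :=
  {x : Fin m × Fin d × Fin d // ¬ x.2 = (j₀, j₀)}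

theorem card_offCorner {d : ℕ} (m : ℕ) (j₀ : Fin d) :
    (Fintype.card (OffCorner m j₀) : ℝ) = ((d : ℝ) ^ 2 - 1) * m := by
  have h1 : Fintype.card {x : Fin m × Fin d × Fin d // x.2 = (j₀, j₀)} = m := by
    rw [Fintype.card_congr (β := Fin m)
      ⟨fun x => x.1.1, fun i => ⟨(i, j₀, j₀), rfl⟩, fun x => by
        obtain ⟨⟨i, y⟩, h⟩ := x; exact Subtype.ext (Prod.ext rfl h.symm), fun i => rfl⟩,
      Fintype.card_fin]
  have h2 := Fintype.card_subtype_compl fun x : Fin m × Fin d × Fin d => x.2 = (j₀, j₀)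
  have h3 := Fintype.card_subtype_le fun x : Fin m × Fin d × Fin d => x.2 = (j₀, j₀)
  rw [h1] at h2 h3
  rw [h2, Nat.cast_sub h3]
  simp
  ring

/-- The tuple with diagonal entries `t` at `j₀` and remaining entries `B`. -/
noncomputable def glue {d m : ℕ} {j₀ : Fin d}
    (t : {x : Fin m × Fin d × Fin d // x.2 = (j₀, j₀)} → ℝ) (B : OffCorner m j₀ → ℝ) :
    TupleSpace d m :=
  WithLp.toLp 2 fun x => if h : x.2 = (j₀, j₀) then t ⟨x, h⟩ else B ⟨x, h⟩

/-- By Fubini, the diagonal entries at `j₀` can be fixed to positive values such that the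
exceptional set has a null slice. -/
theorem exists_volume_slice_eq_zero {d m : ℕ} (hd : 2 ≤ d) (j₀ : Fin d) :
    ∃ t : {x : Fin m × Fin d × Fin d // x.2 = (j₀, j₀)} → ℝ, (∀ x, 0 < t x) ∧
      volume {B : OffCorner m j₀ → ℝ | glue t B ∈ exceptionalTuples m j₀} = 0 := by
  have hmp := (EuclideanSpace.volume_preserving_symm_measurableEquiv_toLp
    (Fin m × Fin d × Fin d)).symm.comp
    (volume_preserving_piEquivPiSubtypeProd (fun _ : Fin m × Fin d × Fin d => ℝ)
      (fun x => x.2 = (j₀, j₀))).symm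
  have h1 : ∀ᵐ a : TupleSpace d m, a ∉ exceptionalTuples m j₀ :=
    measure_eq_zero_iff_ae_notMem.1 (volume_exceptionalTuples hd j₀)
  have h2 := hmp.quasiMeasurePreserving.ae h1
  have h3 := Measure.ae_ae_of_ae_prod h2
  have hopen : IsOpen {t : {x : Fin m × Fin d × Fin d // x.2 = (j₀, j₀)} → ℝ | ∀ x, 0 < t x} := by
    simp only [Set.ofPred_forall]
    exact isOpen_iInter_of_finite fun x => isOpen_lt continuous_const (continuous_apply x)
  obtain ⟨t, ht, h⟩ := (Measure.dense_of_ae h3).inter_open_nonempty _ hopen ⟨1, fun _ => one_pos⟩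
  refine ⟨t, ht, ?_⟩
  have h' : ∀ᵐ B : OffCorner m j₀ → ℝ, glue t B ∉ exceptionalTuples m j₀ := h
  exact measure_eq_zero_iff_ae_notMem.2 h'

/-- Rescaling of each matrix of positive determinant in a tuple to determinant one. -/
noncomputable def normalizeDet {d m : ℕ} (a : TupleSpace d m) : TupleSpace d m :=
  WithLp.toLp 2 fun x => a x / (toTuple a x.1).det ^ (1 / (d : ℝ))

theorem contDiffAt_normalizeDet {d m : ℕ} {a : TupleSpace d m}
    (ha : ∀ i, 0 < (toTuple a i).det) : ContDiffAt ℝ 1 normalizeDet a := by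
  have hcoord : ∀ x, ContDiff ℝ 1 fun a : TupleSpace d m => a x := fun x => by fun_prop
  have hdet : ∀ i, ContDiff ℝ 1 fun a : TupleSpace d m => (toTuple a i).det := by
    intro i
    simp only [Matrix.det_apply', toTuple, Matrix.of_apply]
    exact ContDiff.sum fun σ _ => contDiff_const.mul (contDiff_prod fun j _ => hcoord _)
  refine contDiffAt_euclidean.2 fun x => ?_
  refine (hcoord x).contDiffAt.div
    ((hdet x.1).contDiffAt.rpow_const_of_ne (ha _).ne') (Real.rpow_pos_of_pos (ha _) _).ne'

theorem contDiff_glue {d m : ℕ} {j₀ : Fin d}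
    (t : {x : Fin m × Fin d × Fin d // x.2 = (j₀, j₀)} → ℝ) :
    ContDiff ℝ 1 (glue t : (OffCorner m j₀ → ℝ) → TupleSpace d m) := by
  refine contDiff_euclidean.2 fun x => ?_
  by_cases h : x.2 = (j₀, j₀)
  · simp only [glue, h, dite_true]; exact contDiff_const
  · simp only [glue, h, dite_false]; fun_prop

/-- The exceptional tuples of determinant one form a null set for the Hausdorff measure of the
dimension of `SL_d ^ m`: rescaling each matrix so as to prescribe its diagonal entry at `j₀`, one
recovers them from a null slice of the exceptional set by the locally Lipschitz map
`normalizeDet`. -/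
theorem hausdorffMeasure_exceptionalTuples_inter_SLTuples {d m : ℕ} (hd : 2 ≤ d) (j₀ : Fin d) :
    μH[((d : ℝ) ^ 2 - 1) * m] (exceptionalTuples m j₀ ∩ SLTuples d m) = 0 := by
  obtain ⟨t, ht, hnull⟩ := exists_volume_slice_eq_zero (m := m) hd j₀
  set N : Set (OffCorner m j₀ → ℝ) := {B | glue t B ∈ exceptionalTuples m j₀ ∧
    ∀ i, 0 < (toTuple (glue t B) i).det}
  have hN : μH[((d : ℝ) ^ 2 - 1) * m] N = 0 := by
    rw [← card_offCorner m j₀, hausdorffMeasure_pi_real]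
    exact measure_mono_null (fun B hB => hB.1) hnull
  refine measure_mono_null ?_ (hausdorffMeasure_image_eq_zero_of_contDiffAt
    (by rw [← card_offCorner m j₀]; positivity)
    (fun B hB => (contDiffAt_normalizeDet hB.2).comp B (contDiff_glue t).contDiffAt) hN)
  rintro a ⟨⟨hpos, hnot⟩, hdet⟩
  let c : Fin m → ℝ := fun i => t ⟨(i, j₀, j₀), rfl⟩ / toTuple a i j₀ j₀
  have hc : ∀ i, 0 < c i := fun i => div_pos (ht _) (hpos i j₀ j₀)
  let B : OffCorner m j₀ → ℝ := fun x => c x.1.1 * a x.1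
  have hglue : ∀ x, glue t B x = c x.1 * a x := by
    rintro ⟨i, y⟩
    by_cases h : y = (j₀, j₀)
    · subst h
      simp only [glue, dite_true, c]
      exact (div_mul_cancel₀ _ (hpos i j₀ j₀).ne').symm
    · simp only [glue, h, dite_false, B]
  have htup : toTuple (glue t B) = fun i => c i • toTuple a i := by
    funext i; ext j k
    simp only [toTuple, Matrix.of_apply, hglue, Matrix.smul_apply, smul_eq_mul]
  have hd0 : (d : ℝ) ≠ 0 := by
    have : d ≠ 0 := by omega
    exact_mod_cast this
  have hdetB : ∀ i, (toTuple (glue t B) i).det = c i ^ d := by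
    intro i
    rw [htup, Matrix.det_smul, hdet i, mul_one, Fintype.card_fin]
  refine ⟨B, ⟨⟨fun i j k => ?_, ?_⟩, fun i => by rw [hdetB]; exact pow_pos (hc i) d⟩, ?_⟩
  · rw [htup]; exact mul_pos (hc i) (hpos i j k)
  · rwa [htup, projectivelyDiophantine_smul_iff j₀ _ fun i => (hc i).ne']
  · ext x
    simp only [Function.comp_apply, normalizeDet]
    rw [hdetB, hglue, ← Real.rpow_natCast, ← Real.rpow_mul (hc _).le, mul_one_div_cancel hd0,
      Real.rpow_one, mul_div_cancel_left₀ _ (hc _).ne']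

/-! ### Strongly Diophantine tuples have full measure -/

theorem mainTheorem1 (d m : ℕ) (hd : 2 ≤ d) (hm : 2 ≤ m)
    (v : Fin d → Fin d → ℝ) (hv : LinearIndependent ℝ v) :
    (∀ᵐ a ∂(MeasureTheory.volume : MeasureTheory.Measure (TupleSpace d m)),
        a ∈ GLTuples d m → (∀ i, StrictlyInvariant (coneSpan v) (toTuple a i)) →
          StronglyDiophantine opDist (toTuple a)) ∧
    (∀ᵐ a ∂(MeasureTheory.volume : MeasureTheory.Measure (TupleSpace d m)),
        a ∈ GLTuples d m → (∀ i, PositiveEntries (toTuple a i)) →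
          StronglyDiophantine opDist (toTuple a)) ∧
    (∀ᵐ a ∂(slVolume d m),
        a ∈ SLTuples d m → (∀ i, StrictlyInvariant (coneSpan v) (toTuple a i)) →
          StronglyDiophantine opDist (toTuple a)) ∧
    (∀ᵐ a ∂(slVolume d m),
        a ∈ SLTuples d m → (∀ i, PositiveEntries (toTuple a i)) →
          StronglyDiophantine opDist (toTuple a)) := by
  let j₀ : Fin d := ⟨0, by omega⟩
  let R := mulTuple m (colMatrix v) (colMatrix v)⁻¹
  have hSL : ∀ a ∈ SLTuples d m, ∀ i, (toTuple a i).det ≠ 0 := fun a ha i => by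
    rw [ha i]; exact one_ne_zero
  have hdim : 0 ≤ ((d : ℝ) ^ 2 - 1) * m := by rw [← card_offCorner m j₀]; positivity
  refine ⟨?_, ?_, ?_, ?_⟩
  · have hnull : volume (R '' exceptionalTuples m j₀) = 0 := by
      rw [Measure.addHaar_image_linearMap, volume_exceptionalTuples hd j₀, mul_zero]
    filter_upwards [measure_eq_zero_iff_ae_notMem.1 hnull] with a ha hGL hinv
    by_contra hcon
    obtain ⟨b, hb, -, hba⟩ := exists_mem_exceptionalTuples j₀ hv hGL hinv hcon
    exact ha ⟨b, hb, hba⟩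
  · filter_upwards [ae_projectivelyDiophantine hd j₀] with a ha hGL hpos
    exact (ha hpos).stronglyDiophantine hpos hGL
  · have hnull : μH[((d : ℝ) ^ 2 - 1) * m] (R '' (exceptionalTuples m j₀ ∩ SLTuples d m)) = 0 :=
      hausdorffMeasure_image_eq_zero_of_contDiffAt hdim
        (fun x _ => (LinearMap.toContinuousLinearMap R).contDiff.contDiffAt)
        (hausdorffMeasure_exceptionalTuples_inter_SLTuples hd j₀)
    filter_upwards [ae_restrict_of_ae (measure_eq_zero_iff_ae_notMem.1 hnull)] with a ha hasl hinv
    by_contra hcon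
    obtain ⟨b, hb, hdet, hba⟩ := exists_mem_exceptionalTuples j₀ hv (hSL a hasl) hinv hcon
    exact ha ⟨b, ⟨hb, fun i => (hdet i).trans (hasl i)⟩, hba⟩
  · filter_upwards [ae_restrict_of_ae (measure_eq_zero_iff_ae_notMem.1
      (hausdorffMeasure_exceptionalTuples_inter_SLTuples hd j₀))] with a ha hasl hpos
    have hP : ProjectivelyDiophantine j₀ (toTuple a) := by
      by_contra h
      exact ha ⟨⟨hpos, h⟩, hasl⟩
    exact hP.stronglyDiophantine hpos (hSL a hasl)
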